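/- Let $q:\mathbb R\to\mathbb R$ be locally integrable with $q\ge 0$ almost everywhere, and suppose that $\int_{-\infty}^x q(t)\,dt>0$ and $\int_x^\infty q(t)\,dt>0$ for every $x\in\mathbb R$. For $x\in\mathbb R$ let $d(x)$ denote the unique solution $d>0$ of $$\int_0^{\sqrt2\,d}\int_{x-t}^{x+t}q(\xi)\,d\xi\,dt=2,$$ and put $q^*(x)=d(x)^{-2}$. Suppose that $q\in H$, i.e. $$\lim_{|x|\to\infty} d(x)\int_0^{\sqrt2\,d(x)}\bigl(q(x+t)-q(x-t)\bigr)\,dt=0,$$ and that $$\sup_{x\in\mathbb R}d(x)=\infty,\qquad \int_{-\infty}^0 q^*(x)\,dx=\int_0^\infty q^*(x)\,dx=\infty .$$ For $p\in[1,\infty)$ and a weight (a positive continuous function) $\mu$ on $\mathbb R$ let $L_{p,\mu}$ be the space of all real functions $f\in L_p^{\rm loc}(\mathbb R)$ with $\|f\|_{p,\mu}=\bigl(\int_{\mathbb R}|\mu f|^p\,dx\bigr)^{1/p}<\infty$, and $L_p=L_{p,1}$. A solution of $$-y''(x)+q(x)y(x)=f(x),\quad x\in\mathbb R,\tag{1}$$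 is a differentiable function $y$ such that $y$ and $y'$ are absolutely continuous on every finite segment and (1) holds almost everywhere. For weights $\mu,\theta$ the pair $\{L_{p,\mu};L_{p,\theta}\}$ is called admissible for (1) if for every $f\in L_{p,\theta}$ there is exactly one solution $y\in L_{p,\mu}$ of (1), and there is a constant $c\in(0,\infty)$, independent of $f$, such that $\|y\|_{p,\mu}\le c\,\|f\|_{p,\theta}$ for all $f\in L_{p,\theta}$. Then: A) for every $p\in[1,\infty)$ the pair $\{L_p;L_p\}$ is not admissible for (1); B) for every $p\in[1,\infty)$ the function $q^*$ is a weight and the pair $\{L_{p,q^*};L_p\}$ is admissible for (1). -/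

import Mathlib

open MeasureTheory Set Filter Topology
open scoped ENNReal

namespace SturmLiouville

/-- The function `η ↦ ∫₀^{√2 η} ∫_{x-t}^{x+t} q(ξ) dξ dt`. -/
noncomputable def F (q : ℝ → ℝ) (x η : ℝ) : ℝ :=
  ∫ t in (0 : ℝ)..(Real.sqrt 2 * η), ∫ ξ in (x - t)..(x + t), q ξ

/-- Condition `∫_{-∞}^x q > 0` and `∫_x^∞ q > 0` for all real `x`.  The integrals of the
nonnegative function `q` may be infinite, hence are taken with values in `[0, ∞]`. -/
def PositiveTails (q : ℝ → ℝ) : Prop :=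
  ∀ x : ℝ, 0 < ∫⁻ t in Iic x, ENNReal.ofReal (q t) ∧ 0 < ∫⁻ t in Ici x, ENNReal.ofReal (q t)

/-- The auxiliary function `d`: for each `x`, the solution `d ≥ 0` of
`∫₀^{√2 d} ∫_{x-t}^{x+t} q(ξ) dξ dt = 2`.  It exists, is unique and is positive under the standing
assumptions on `q`, see `existsUnique_F_eq_two` and `d_spec` below, so the infimum below is taken
over a one-point set. -/
noncomputable def d (q : ℝ → ℝ) (x : ℝ) : ℝ :=
  sInf {η : ℝ | 0 ≤ η ∧ F q x η = 2}

/-- The function `q* = d⁻²`. -/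
noncomputable def qStar (q : ℝ → ℝ) (x : ℝ) : ℝ := 1 / (d q x) ^ 2

/-- The function `ν(x) = d(x) ∫₀^{√2 d(x)} (q(x+t) - q(x-t)) dt`. -/
noncomputable def nu (q : ℝ → ℝ) (x : ℝ) : ℝ :=
  d q x * ∫ t in (0 : ℝ)..(Real.sqrt 2 * d q x), (q (x + t) - q (x - t))

/-- The class `H`: `ν(x) → 0` as `|x| → ∞`. -/
def InClassH (q : ℝ → ℝ) : Prop := Tendsto (nu q) (atBot ⊔ atTop) (𝓝 0)

/-- Weights are positive continuous functions on the real line. -/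
def IsWeight (μ : ℝ → ℝ) : Prop := Continuous μ ∧ ∀ x, 0 < μ x

/-- `f ∈ L_{p,μ}`: `f` is locally in `L_p` and `∫ |μ f|^p < ∞`. -/
def MemWeightedLp (p : ℝ≥0∞) (μ f : ℝ → ℝ) : Prop :=
  (∀ K : Set ℝ, IsCompact K → MemLp f p (volume.restrict K)) ∧
    MemLp (fun x => μ x * f x) p volume

/-- The norm `‖f‖_{p,μ} = (∫ |μ f|^p)^{1/p}`, with values in `[0, ∞]`. -/
noncomputable def weightedNorm (p : ℝ≥0∞) (μ f : ℝ → ℝ) : ℝ≥0∞ :=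
  eLpNorm (fun x => μ x * f x) p volume

/-- `y` is a solution of `-y'' + q y = f`: `y` is differentiable, `y` and `y'` are absolutely
continuous on every finite segment, and the equation holds almost everywhere. -/
def IsSolution (q f y : ℝ → ℝ) : Prop :=
  Differentiable ℝ y ∧
  (∀ a b : ℝ, AbsolutelyContinuousOnInterval y a b) ∧
  (∀ a b : ℝ, AbsolutelyContinuousOnInterval (deriv y) a b) ∧
  ∀ᵐ x : ℝ, -deriv (deriv y) x + q x * y x = f x

/-- The pair `{L_{p,μ}; L_{p,θ}}` (`μ`, `θ` weights) is admissible for `-y'' + q y = f`: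
every `f ∈ L_{p,θ}` has exactly one solution `y ∈ L_{p,μ}`, and `‖y‖_{p,μ} ≤ c ‖f‖_{p,θ}`
with a finite constant `c` independent of `f`. -/
def Admissible (q : ℝ → ℝ) (p : ℝ≥0∞) (μ θ : ℝ → ℝ) : Prop :=
  IsWeight μ ∧ IsWeight θ ∧
  (∀ f : ℝ → ℝ, MemWeightedLp p θ f → ∃! y : ℝ → ℝ, IsSolution q f y ∧ MemWeightedLp p μ y) ∧
  ∃ c : ℝ, 0 < c ∧ ∀ f y : ℝ → ℝ, MemWeightedLp p θ f → IsSolution q f y → MemWeightedLp p μ y →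
    weightedNorm p μ y ≤ ENNReal.ofReal c * weightedNorm p θ f

/-- Existence, uniqueness and positivity of the value `d(x)`. -/
theorem existsUnique_F_eq_two {q : ℝ → ℝ} (hq : LocallyIntegrable q volume)
    (hq0 : ∀ᵐ x : ℝ, 0 ≤ q x) (ht : PositiveTails q) (x : ℝ) :
    ∃ η : ℝ, 0 < η ∧ {η : ℝ | 0 ≤ η ∧ F q x η = 2} = {η} := by
  have hii : ∀ a b : ℝ, IntervalIntegrable q volume a b := fun a b =>
    (hq.integrableOn_isCompact isCompact_uIcc).intervalIntegrable
  set g : ℝ → ℝ := fun t => ∫ ξ in (x - t)..(x + t), q ξ with hg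
  have hgP : ∀ t, g t = (∫ ξ in (0 : ℝ)..(x + t), q ξ) - ∫ ξ in (0 : ℝ)..(x - t), q ξ :=
    fun t => (intervalIntegral.integral_interval_sub_left (hii _ _) (hii _ _)).symm
  have hP : Continuous fun b => ∫ ξ in (0 : ℝ)..b, q ξ :=
    intervalIntegral.continuous_primitive hii 0
  have hgc : Continuous g := by
    have : g = fun t => (∫ ξ in (0 : ℝ)..(x + t), q ξ) - ∫ ξ in (0 : ℝ)..(x - t), q ξ :=
      funext hgP
    rw [this]
    exact (hP.comp (by fun_prop : Continuous fun t => x + t)).sub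
      (hP.comp (by fun_prop : Continuous fun t => x - t))
  have hPm : Monotone fun b => ∫ ξ in (0 : ℝ)..b, q ξ := by
    intro a b hab
    have h1 := intervalIntegral.integral_interval_sub_left (hii 0 b) (hii 0 a)
    have h2 : 0 ≤ ∫ ξ in a..b, q ξ :=
      intervalIntegral.integral_nonneg_of_ae hab hq0
    simp only
    linarith
  have hgm : Monotone g := by
    intro s t hst
    rw [hgP, hgP]
    have h1 := hPm (by linarith : x + s ≤ x + t)
    have h2 := hPm (by linarith : x - t ≤ x - s)
    simp only at h1 h2
    linarith
  have hg00 : g 0 = 0 := by simp [hg]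
  have hg0 : ∀ t, 0 ≤ t → 0 ≤ g t := fun t h => hg00 ▸ hgm h
  have hgi : ∀ a b : ℝ, IntervalIntegrable g volume a b := fun a b => hgc.intervalIntegrable a b
  have hs : 0 < Real.sqrt 2 := by positivity
  have hFs : ∀ a b : ℝ, a ≤ b → F q x a + Real.sqrt 2 * (b - a) * g (Real.sqrt 2 * a) ≤ F q x b := by
    intro a b hab
    have hab' : Real.sqrt 2 * a ≤ Real.sqrt 2 * b := by gcongr
    have h1 : F q x b - F q x a = ∫ t in (Real.sqrt 2 * a)..(Real.sqrt 2 * b), g t :=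
      intervalIntegral.integral_interval_sub_left (hgi _ _) (hgi _ _)
    have h2 : ∫ t in (Real.sqrt 2 * a)..(Real.sqrt 2 * b), g (Real.sqrt 2 * a) ≤
        ∫ t in (Real.sqrt 2 * a)..(Real.sqrt 2 * b), g t :=
      intervalIntegral.integral_mono_on hab' (by simp) (hgi _ _) fun t h => hgm h.1
    rw [intervalIntegral.integral_const, smul_eq_mul] at h2
    nlinarith
  have hF0 : F q x 0 = 0 := by simp [F]
  have hFup : ∀ a : ℝ, 0 ≤ a → F q x a ≤ Real.sqrt 2 * a * g (Real.sqrt 2 * a) := by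
    intro a ha
    have h2 : ∫ t in (0 : ℝ)..(Real.sqrt 2 * a), g t ≤
        ∫ t in (0 : ℝ)..(Real.sqrt 2 * a), g (Real.sqrt 2 * a) :=
      intervalIntegral.integral_mono_on (by positivity) (hgi _ _) (by simp) fun t h => hgm h.2
    rw [intervalIntegral.integral_const, smul_eq_mul, sub_zero] at h2
    exact h2
  have hFc : Continuous (F q x) :=
    (intervalIntegral.continuous_primitive hgi 0).comp
      (by fun_prop : Continuous fun η : ℝ => Real.sqrt 2 * η)
  obtain ⟨T, hT0, hT⟩ : ∃ T : ℝ, 0 < T ∧ 0 < g (Real.sqrt 2 * T) := by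
    by_contra! hcon
    have hz : ∀ n : ℕ, ∀ᵐ t ∂(volume.restrict (Icc x (x + n))), ENNReal.ofReal (q t) = 0 := by
      intro n
      have h0 : ∫ ξ in x..(x + n), q ξ = 0 := by
        rcases n.eq_zero_or_pos with rfl | hn
        · simp
        have hn' : (0 : ℝ) < n := by exact_mod_cast hn
        have h1 : g n ≤ 0 := by
          have := hcon (n / Real.sqrt 2) (by positivity)
          rwa [mul_div_cancel₀ _ hs.ne'] at this
        have h2 : (0 : ℝ) ≤ ∫ ξ in x..(x + n), q ξ :=
          intervalIntegral.integral_nonneg_of_ae (by linarith) hq0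
        have h3 : (0 : ℝ) ≤ ∫ ξ in (x - n)..x, q ξ :=
          intervalIntegral.integral_nonneg_of_ae (by linarith) hq0
        have h4 : (∫ ξ in (x - n)..x, q ξ) + ∫ ξ in x..(x + n), q ξ = g n :=
          intervalIntegral.integral_add_adjacent_intervals (hii _ _) (hii _ _)
        linarith
      have hn0 : (0 : ℝ) ≤ n := n.cast_nonneg
      rw [intervalIntegral.integral_of_le (by linarith), ← integral_Icc_eq_integral_Ioc,
        integral_eq_zero_iff_of_nonneg_ae (ae_restrict_of_ae hq0)
          (hq.integrableOn_isCompact isCompact_Icc)] at h0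
      filter_upwards [h0] with t h
      simp [h]
    have hU : (⋃ n : ℕ, Icc x (x + n)) = Ici x := by
      ext t
      simp only [mem_iUnion, mem_Icc, mem_Ici]
      refine ⟨fun ⟨n, h⟩ => h.1, fun h => ?_⟩
      obtain ⟨n, hn⟩ := exists_nat_ge (t - x)
      exact ⟨n, h, by linarith⟩
    have hz' : ∀ᵐ t ∂(volume.restrict (Ici x)), ENNReal.ofReal (q t) = 0 := by
      rw [← hU, ae_restrict_iUnion_iff]
      exact hz
    have := (ht x).2
    rw [lintegral_congr_ae hz'] at this
    simp at this
  obtain ⟨η, hη, hη2⟩ : ∃ η : ℝ, 0 ≤ η ∧ F q x η = 2 := by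
    have hc : 0 < Real.sqrt 2 * g (Real.sqrt 2 * T) := by positivity
    set B : ℝ := T + 2 / (Real.sqrt 2 * g (Real.sqrt 2 * T)) with hB
    have hTB : T ≤ B := by rw [hB]; linarith [div_pos two_pos hc]
    have h1 := hFs T B hTB
    have h2 := hFs 0 T hT0.le
    have h3 : Real.sqrt 2 * (B - T) * g (Real.sqrt 2 * T) = 2 := by
      have : B - T = 2 / (Real.sqrt 2 * g (Real.sqrt 2 * T)) := by rw [hB]; ring
      rw [this]
      field_simp
    rw [mul_zero, hg00, hF0] at h2
    have := intermediate_value_Icc (hT0.le.trans hTB) hFc.continuousOn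
    obtain ⟨η, h, h'⟩ := this (show (2 : ℝ) ∈ Icc (F q x 0) (F q x B) by
      rw [hF0]; constructor <;> linarith)
    exact ⟨η, h.1, h'⟩
  have hlt : ∀ a b : ℝ, 0 ≤ a → a < b → F q x a = 2 → F q x b = 2 → False := by
    intro a b ha hab h1 h2
    have h3 := hFs a b hab.le
    have h4 := hFup a ha
    have h5 : 0 < g (Real.sqrt 2 * a) := by
      by_contra hle
      have : Real.sqrt 2 * a * g (Real.sqrt 2 * a) ≤ 0 :=
        mul_nonpos_of_nonneg_of_nonpos (by positivity) (not_lt.mp hle)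
      linarith
    have h6 : 0 < Real.sqrt 2 * (b - a) * g (Real.sqrt 2 * a) :=
      mul_pos (mul_pos hs (sub_pos.mpr hab)) h5
    linarith
  refine ⟨η, lt_of_le_of_ne hη ?_, ?_⟩
  · rintro rfl
    rw [hF0] at hη2
    norm_num at hη2
  · ext b
    simp only [mem_ofPred_eq, mem_singleton_iff]
    constructor
    · rintro ⟨hb, hb2⟩
      rcases lt_trichotomy b η with h | h | h
      · exact (hlt b η hb h hb2 hη2).elim
      · exact h
      · exact (hlt η b hη h hη2 hb2).elim
    · rintro rfl
      exact ⟨hη, hη2⟩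

/-- `d(x)` is the unique nonnegative root of its defining equation, and it is positive. -/
theorem d_spec {q : ℝ → ℝ} (hq : LocallyIntegrable q volume)
    (hq0 : ∀ᵐ x : ℝ, 0 ≤ q x) (ht : PositiveTails q) (x : ℝ) :
    0 < d q x ∧ F q x (d q x) = 2 ∧ ∀ η : ℝ, 0 ≤ η → F q x η = 2 → η = d q x := by
  obtain ⟨η, hη, hs⟩ := existsUnique_F_eq_two hq hq0 ht x
  have hd : d q x = η := by rw [d, hs, csInf_singleton]
  have hm : η ∈ {η : ℝ | 0 ≤ η ∧ F q x η = 2} := by rw [hs]; rfl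
  rw [hd]
  refine ⟨hη, hm.2, fun b hb hb2 => ?_⟩
  have : b ∈ {η : ℝ | 0 ≤ η ∧ F q x η = 2} := ⟨hb, hb2⟩
  rwa [hs] at this

end SturmLiouville

/-! Put `s = √2 d`, `Q' = q` a.e. and `P' = Q`. The equation for `d` says that the convex function
`P` has second difference 2 at step `s`, and `q* = 2 / s²`. Convexity makes `s` 1-Lipschitz, and
implicit differentiation makes it differentiable. The mass of `q` on `[x - s, x + s]` is at least `2
/ s`, so condition `H` forces `s' → 0` and puts at least `1 / (2s)` of mass in each half of the
window for large `|x|`.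

A) Near a point where `s` is large, `q` is negligible: on a window of radius `δ = s / 8` the
solution with data `(1, 0)` at the centre stays between 1 and 2. Cutting it off at scale `δ` gives
`y` of size 1 with right-hand side `O(δ⁻²)`, both on length of order `δ`. Hence `‖y‖_p / ‖f‖_p` is
at least of order `δ²`, which is unbounded.

B) The increasing positive solution `u` is convex, and the mass in the left half-window gives `u ≤ 3
s u'` far out, hence `κ u ≤ s u'` everywhere for some `κ > 0`. Since `|s'|` is eventually at most `κ
/ 4`, the derivatives of `u s` and `u / s` there dominate multiples of `u` and `u / s²`; after a
bounded correction on a compact set, `∫_{-∞}^x u ≤ C u s` and `∫_{-∞}^x u / s² ≤ C u / s`.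
Reflection treats the decreasing solution `v`. The Wronskian identity gives `u v ≤ C s`, so the
Green kernel multiplied by `2 / s²` has bounded row and column integrals, and Schur's test proves
the estimate for every `p`. For uniqueness, `u / s²` is eventually increasing, so it is bounded
below at `+∞`, and likewise `v / s²` at `-∞`; no nonzero homogeneous solution then lies in the
weighted space.

As `q` is only locally integrable, second derivatives exist only almost everywhere; the calculus is
therefore done with indefinite integrals. -/

namespace SturmLiouville

/-! ### Calculus of indefinite integrals. -/

/-- `y` is an indefinite integral of the locally integrable function `g`. -/
def IsPrim (y g : ℝ → ℝ) : Prop :=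
  (∀ a b : ℝ, IntervalIntegrable g volume a b) ∧ ∀ a b : ℝ, ∫ t in a..b, g t = y b - y a

namespace IsPrim

variable {y g w h : ℝ → ℝ}

theorem eq_add (hy : IsPrim y g) (a x : ℝ) : y x = y a + ∫ t in a..x, g t := by
  rw [hy.2 a x]; ring

theorem absolutelyContinuous (hy : IsPrim y g) (a b : ℝ) :
    AbsolutelyContinuousOnInterval y a b := by
  have h1 := ((hy.1 a b).absolutelyContinuousOnInterval_intervalIntegral (c := a)
    left_mem_uIcc)
  have h2 : AbsolutelyContinuousOnInterval (fun _ : ℝ => y a) a b :=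
    ((LipschitzWith.const (y a)).lipschitzOnWith (s := uIcc a b)).absolutelyContinuousOnInterval
  have h3 := h2.add h1
  have : y = (fun _ : ℝ => y a) + fun x => ∫ t in a..x, g t := by
    funext x
    simpa using hy.eq_add a x
  rwa [this]

theorem ae_hasDerivAt (hy : IsPrim y g) : ∀ᵐ x : ℝ, HasDerivAt y (g x) x := by
  have hl : LocallyIntegrable g volume := by
    rw [locallyIntegrable_iff]
    intro K hK
    obtain ⟨R, hR⟩ := hK.isBounded.subset_closedBall 0
    rw [Real.closedBall_eq_Icc] at hR
    rcases le_or_gt (0 - R) (0 + R) with h | h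
    · exact ((intervalIntegrable_iff_integrableOn_Icc_of_le h).1 (hy.1 _ _)).mono_set hR
    · rw [Icc_eq_empty (not_le.2 h)] at hR
      exact integrableOn_empty.mono_set hR
  filter_upwards [LocallyIntegrable.ae_hasDerivAt_integral hl] with x hx
  have h2 := (hx 0).const_add (y 0)
  exact h2.congr_of_eventuallyEq (Eventually.of_forall fun t => hy.eq_add 0 t)

theorem continuous (hy : IsPrim y g) : Continuous y := by
  have h1 := (intervalIntegral.continuous_primitive hy.1 0).const_add (y 0)
  have : y = fun x => y 0 + ∫ t in (0 : ℝ)..x, g t := funext fun x => hy.eq_add 0 x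
  rwa [this]

theorem hasDerivAt (hy : IsPrim y g) (hg : Continuous g) (x : ℝ) : HasDerivAt y (g x) x := by
  have h1 := (intervalIntegral.integral_hasDerivAt_right (hy.1 0 x)
    (hg.stronglyMeasurableAtFilter _ _) hg.continuousAt).const_add (y 0)
  exact h1.congr_of_eventuallyEq (Eventually.of_forall fun t => hy.eq_add 0 t)

theorem congr_ae {g' : ℝ → ℝ} (hy : IsPrim y g) (hg : ∀ᵐ x : ℝ, g x = g' x) : IsPrim y g' := by
  refine ⟨fun a b => (hy.1 a b).congr_ae (ae_restrict_of_ae hg), fun a b => ?_⟩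
  rw [← hy.2 a b]
  exact intervalIntegral.integral_congr_ae (hg.mono fun x hx _ => hx.symm)

theorem of_absolutelyContinuous (hy : ∀ a b : ℝ, AbsolutelyContinuousOnInterval y a b) :
    IsPrim y (deriv y) :=
  ⟨fun a b => (hy a b).intervalIntegrable_deriv, fun a b => (hy a b).integral_deriv_eq_sub⟩

theorem of_hasDerivAt (hy : ∀ x, HasDerivAt y (g x) x) (hg : Continuous g) : IsPrim y g :=
  ⟨fun a b => hg.intervalIntegrable a b, fun a b =>
    intervalIntegral.integral_eq_sub_of_hasDerivAt (fun x _ => hy x) (hg.intervalIntegrable a b)⟩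

/-- A product of absolutely continuous functions is absolutely continuous, hence the integral of its
a.e. derivative, which the product rule identifies. -/
theorem mul (hy : IsPrim y g) (hw : IsPrim w h) :
    IsPrim (fun x => y x * w x) (fun x => g x * w x + y x * h x) := by
  have h1 := of_absolutelyContinuous fun a b =>
    (hy.absolutelyContinuous a b).fun_mul (hw.absolutelyContinuous a b)
  refine h1.congr_ae ?_
  filter_upwards [hy.ae_hasDerivAt, hw.ae_hasDerivAt] with x h2 h3
  exact (h2.fun_mul h3).deriv

theorem add (hy : IsPrim y g) (hw : IsPrim w h) :
    IsPrim (fun x => y x + w x) (fun x => g x + h x) := by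
  refine ⟨fun a b => (hy.1 a b).add (hw.1 a b), fun a b => ?_⟩
  rw [intervalIntegral.integral_add (hy.1 a b) (hw.1 a b), hy.2, hw.2]; ring

theorem sub (hy : IsPrim y g) (hw : IsPrim w h) :
    IsPrim (fun x => y x - w x) (fun x => g x - h x) := by
  refine ⟨fun a b => (hy.1 a b).sub (hw.1 a b), fun a b => ?_⟩
  rw [intervalIntegral.integral_sub (hy.1 a b) (hw.1 a b), hy.2, hw.2]; ring

theorem const_mul (c : ℝ) (hy : IsPrim y g) :
    IsPrim (fun x => c * y x) (fun x => c * g x) := by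
  refine ⟨fun a b => (hy.1 a b).const_mul c, fun a b => ?_⟩
  rw [intervalIntegral.integral_const_mul, hy.2]; ring

theorem neg (hy : IsPrim y g) : IsPrim (fun x => -y x) (fun x => -g x) := by
  simpa using hy.const_mul (-1)

theorem comp_neg (hy : IsPrim y g) : IsPrim (fun x => y (-x)) (fun x => -g (-x)) := by
  refine ⟨fun a b => ?_, fun a b => ?_⟩
  · exact ((IntervalIntegrable.iff_comp_neg (a := a) (b := b) (f := fun x => g (-x))).2
      (by simpa using hy.1 (-a) (-b))).neg
  · rw [intervalIntegral.integral_neg, intervalIntegral.integral_comp_neg, hy.2]; ring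

theorem comp_add_right (hy : IsPrim y g) (c : ℝ) :
    IsPrim (fun x => y (x + c)) (fun x => g (x + c)) := by
  refine ⟨fun a b => ?_, fun a b => ?_⟩
  · simpa using (hy.1 (a + c) (b + c)).comp_add_right c
  · rw [intervalIntegral.integral_comp_add_right, hy.2]

theorem eq_of_zero (hy : IsPrim y g) (hg : ∀ x, g x = 0) (a b : ℝ) : y a = y b := by
  have := hy.2 a b
  simp [hg] at this
  linarith

theorem of_intervalIntegrable (hg : ∀ a b : ℝ, IntervalIntegrable g volume a b) (c : ℝ) :
    IsPrim (fun x => ∫ t in c..x, g t) g :=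
  ⟨hg, fun _ _ => (intervalIntegral.integral_interval_sub_left (hg _ _) (hg _ _)).symm⟩

theorem monotone (hy : IsPrim y g) (hg : ∀ᵐ x : ℝ, 0 ≤ g x) : Monotone y := by
  intro a b hab
  have h1 := hy.2 a b
  have h2 : 0 ≤ ∫ t in a..b, g t := intervalIntegral.integral_nonneg_of_ae hab hg
  linarith

theorem pow (hy : IsPrim y g) (n : ℕ) :
    IsPrim (fun x => y x ^ (n + 1)) (fun x => (n + 1) * (g x * y x ^ n)) := by
  induction n with
  | zero => simpa using hy
  | succ n ih =>
    have := ih.mul hy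
    have h2 : (fun x => y x ^ (n + 1) * y x) = fun x => y x ^ (n + 1 + 1) :=
      funext fun x => (pow_succ _ _).symm
    rw [h2] at this
    refine this.congr_ae (Eventually.of_forall fun x => ?_)
    push_cast; ring

end IsPrim

/-! ### The homogeneous equation and its Cauchy problem. -/

/-- `u` solves `u'' = q u`, with derivative `u'`. -/
structure IsHom (q u u' : ℝ → ℝ) : Prop where
  hasDerivAt : ∀ x, HasDerivAt u (u' x) x
  prim : IsPrim u' fun x => q x * u x

namespace IsHom

variable {q u u' v v' : ℝ → ℝ}

theorem continuous (hu : IsHom q u u') : Continuous u :=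
  continuous_iff_continuousAt.2 fun x => (hu.hasDerivAt x).continuousAt

theorem prim' (hu : IsHom q u u') : IsPrim u u' :=
  IsPrim.of_hasDerivAt hu.hasDerivAt hu.prim.continuous

theorem comp_neg (hu : IsHom q u u') :
    IsHom (fun x => q (-x)) (fun x => u (-x)) (fun x => -u' (-x)) where
  hasDerivAt x := by
    simpa [Function.comp_def] using (hu.hasDerivAt (-x)).scomp x (hasDerivAt_neg x)
  prim := by
    simpa using hu.prim.comp_neg.neg

/-- The Wronskian of two solutions is constant. -/
theorem wronskian (hu : IsHom q u u') (hv : IsHom q v v') (a b : ℝ) :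
    u' a * v a - u a * v' a = u' b * v b - u b * v' b :=
  ((hu.prim.mul hv.prim').sub (hu.prim'.mul hv.prim)).eq_of_zero (fun x => by ring) a b

end IsHom

/-- Picard iterates for the Cauchy problem `z'' = q z`, `z(0) = 1`, `z'(0) = 0`. -/
noncomputable def picard (q : ℝ → ℝ) : ℕ → ℝ → ℝ
  | 0 => fun _ => 1
  | n + 1 => fun x => ∫ t in (0 : ℝ)..x, (x - t) * (q t * picard q n t)

section Picard

variable {q : ℝ → ℝ}

/-- Splitting the kernel as `x` times an integral minus `∫ t g`, the two terms `x g` in the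
derivative cancel. Thus one Picard step is a double integration. -/
theorem prim_mul_iterated {g : ℝ → ℝ} (hg : ∀ a b : ℝ, IntervalIntegrable g volume a b) :
    IsPrim (fun x => ∫ t in (0 : ℝ)..x, (x - t) * g t) (fun x => ∫ t in (0 : ℝ)..x, g t) := by
  have h1 := IsPrim.of_intervalIntegrable hg 0
  have hi : ∀ a b : ℝ, IntervalIntegrable (fun t => t * g t) volume a b := fun a b =>
    (hg a b).continuousOn_mul continuous_id.continuousOn
  have h2 := IsPrim.of_intervalIntegrable hi 0
  have h3 : IsPrim (fun x : ℝ => x) fun _ => 1 :=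
    IsPrim.of_hasDerivAt (fun x => hasDerivAt_id x) continuous_const
  have h4 := (h3.mul h1).sub h2
  have h5 : (fun x => ∫ t in (0 : ℝ)..x, (x - t) * g t) =
      fun x => (x * ∫ t in (0 : ℝ)..x, g t) - ∫ t in (0 : ℝ)..x, t * g t := by
    funext x
    rw [← intervalIntegral.integral_const_mul,
      ← intervalIntegral.integral_sub ((hg 0 x).const_mul x) (hi 0 x)]
    congr 1
    funext t
    ring
  rw [h5]
  exact h4.congr_ae (Eventually.of_forall fun x => by ring)

theorem continuous_picard (hq : ∀ a b : ℝ, IntervalIntegrable q volume a b) (n : ℕ) : Continuous (picard q n) := by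
  induction n with
  | zero => exact continuous_const
  | succ n ih =>
    exact (prim_mul_iterated fun a b => (hq a b).mul_continuousOn ih.continuousOn).continuous

theorem picard_nonneg (hq0 : ∀ᵐ x : ℝ, 0 ≤ q x) (n : ℕ) : ∀ x, 0 ≤ picard q n x := by
  induction n with
  | zero => exact fun _ => zero_le_one
  | succ n ih =>
    intro x
    change 0 ≤ ∫ t in (0 : ℝ)..x, (x - t) * (q t * picard q n t)
    rcases le_total 0 x with h | h
    · refine intervalIntegral.integral_nonneg_of_ae_restrict h ?_
      filter_upwards [ae_restrict_of_ae hq0, ae_restrict_mem measurableSet_Icc] with t h1 h2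
      exact mul_nonneg (sub_nonneg.2 h2.2) (mul_nonneg h1 (ih t))
    · rw [intervalIntegral.integral_symm, ← intervalIntegral.integral_neg]
      refine intervalIntegral.integral_nonneg_of_ae_restrict h ?_
      filter_upwards [ae_restrict_of_ae hq0, ae_restrict_mem measurableSet_Icc] with t h1 h2
      have := mul_nonneg (sub_nonneg.2 h2.1) (mul_nonneg h1 (ih t))
      simp only [Pi.zero_apply]
      linarith

/-- The factors `|x - t|` and `|t|` are at most `|x|`, and what remains, `q Qⁿ`, integrates exactly
to `Qⁿ⁺¹ / (n + 1)`; this produces the factorial. -/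
theorem picard_le (hq : ∀ a b : ℝ, IntervalIntegrable q volume a b)
    (hq0 : ∀ᵐ x : ℝ, 0 ≤ q x) (n : ℕ) :
    ∀ x, picard q n x ≤ (|x| * |∫ t in (0 : ℝ)..x, q t|) ^ n / n.factorial := by
  have hQ := IsPrim.of_intervalIntegrable hq 0
  set Q : ℝ → ℝ := fun x => ∫ t in (0 : ℝ)..x, q t with hQdef
  have hQ0 : Q 0 = 0 := by simp [hQdef]
  have hmono := hQ.monotone hq0
  induction n with
  | zero => intro x; simp [picard]
  | succ n ih =>
    intro x
    -- `σ` is the sign of `x`, which lets both half-lines share one computation.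
    obtain ⟨σ, hσ, hσ1⟩ : ∃ σ : ℝ, |σ| = 1 ∧ ∀ t ∈ uIoc (0 : ℝ) x, |t| ≤ |x| ∧ |x - t| ≤ |x| ∧
        |Q t| = σ * Q t := by
      rcases le_total 0 x with h | h
      · refine ⟨1, by simp, fun t ht => ?_⟩
        rw [uIoc_of_le h] at ht
        have h1 : 0 ≤ Q t := hQ0 ▸ hmono ht.1.le
        rw [abs_of_nonneg h, abs_of_pos ht.1, abs_of_nonneg (sub_nonneg.2 ht.2), abs_of_nonneg h1]
        exact ⟨ht.2, by linarith [ht.1], by ring⟩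
      · refine ⟨-1, by simp, fun t ht => ?_⟩
        rw [uIoc_of_ge h] at ht
        have h1 : Q t ≤ 0 := hQ0 ▸ hmono ht.2
        rw [abs_of_nonpos h, abs_of_nonpos ht.2, abs_of_neg (sub_neg.2 ht.1), abs_of_nonpos h1]
        exact ⟨by linarith [ht.1], by linarith [ht.2], by ring⟩
    have hp := hQ.pow n
    have hi : ∀ a b : ℝ, IntervalIntegrable (fun t => q t * Q t ^ n) volume a b := fun a b =>
      (hq a b).mul_continuousOn (hQ.continuous.pow n).continuousOn
    have h1 : (n + 1 : ℝ) * ∫ t in (0 : ℝ)..x, q t * Q t ^ n = Q x ^ (n + 1) := by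
      rw [← intervalIntegral.integral_const_mul, hp.2 0 x]; simp [hQ0]
    have h2 : ‖∫ t in (0 : ℝ)..x, (x - t) * (q t * picard q n t)‖ ≤
        |∫ t in (0 : ℝ)..x, (|x| ^ (n + 1) * σ ^ n / n.factorial) * (q t * Q t ^ n)| := by
      refine intervalIntegral.norm_integral_le_abs_of_norm_le ?_ ((hi 0 x).const_mul _)
      filter_upwards [ae_restrict_of_ae hq0, ae_restrict_mem measurableSet_uIoc] with t h3 h4
      obtain ⟨h5, h6, h7⟩ := hσ1 t h4
      rw [norm_mul, norm_mul, Real.norm_eq_abs, Real.norm_eq_abs, Real.norm_eq_abs,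
        abs_of_nonneg h3, abs_of_nonneg (picard_nonneg hq0 n t)]
      calc |x - t| * (q t * picard q n t)
          ≤ |x| * (q t * ((|x| * |Q t|) ^ n / n.factorial)) := by
            have h8 : picard q n t ≤ (|x| * |Q t|) ^ n / n.factorial :=
              (ih t).trans (by gcongr)
            have h9 := picard_nonneg hq0 n t
            gcongr
        _ = _ := by rw [h7]; ring
    rw [intervalIntegral.integral_const_mul, Real.norm_eq_abs] at h2
    refine (le_abs_self _).trans (h2.trans (le_of_eq ?_))
    have hn : (n + 1 : ℝ) ≠ 0 := by positivity
    rw [eq_div_of_mul_eq hn ((mul_comm _ _).trans h1), Nat.factorial_succ]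
    simp only [abs_mul, abs_div, abs_pow, hσ, abs_abs, one_pow, Nat.abs_cast]
    push_cast
    rw [abs_of_pos (by positivity : (0 : ℝ) < n + 1)]
    change _ = (|x| * |Q x|) ^ (n + 1) / _
    rw [mul_pow]
    field_simp

/-- The solution of `z'' = q z` with `z(0) = 1`, `z'(0) = 0`. -/
theorem exists_cauchy_zero (hq : ∀ a b : ℝ, IntervalIntegrable q volume a b)
    (hq0 : ∀ᵐ x : ℝ, 0 ≤ q x) :
    ∃ z z' : ℝ → ℝ, IsHom q z z' ∧ z 0 = 1 ∧ z' 0 = 0 ∧ ∀ x, 1 ≤ z x := by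
  have hQ := IsPrim.of_intervalIntegrable hq 0
  have hmono := hQ.monotone hq0
  have hc := continuous_picard hq
  -- On bounded intervals the iterates are dominated by an exponential series; this gives continuity
  -- of the sum and termwise integration.
  have hb : ∀ R : ℝ, 0 ≤ R → ∃ B : ℝ, ∀ n, ∀ x ∈ Icc (-R) R,
      ‖picard q n x‖ ≤ B ^ n / n.factorial := by
    intro R hR
    obtain ⟨C, hC⟩ := isCompact_Icc.exists_bound_of_continuousOn
      (hQ.continuous.continuousOn (s := Icc (-R) R))
    refine ⟨R * C, fun n x hx => ?_⟩
    rw [Real.norm_eq_abs, abs_of_nonneg (picard_nonneg hq0 n x)]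
    refine (picard_le hq hq0 n x).trans ?_
    gcongr
    · exact abs_le.2 hx
    · exact hC x hx
  have hsum : ∀ x, HasSum (fun n => picard q n x) (∑' n, picard q n x) := by
    intro x
    obtain ⟨B, hB⟩ := hb |x| (abs_nonneg x)
    exact (Summable.of_norm_bounded (Real.summable_pow_div_factorial B)
      fun n => hB n x (abs_le.1 le_rfl)).hasSum
  set z : ℝ → ℝ := fun x => ∑' n, picard q n x with hz
  have hzc : Continuous z := by
    rw [continuous_iff_continuousAt]
    intro x
    obtain ⟨B, hB⟩ := hb (|x| + 1) (by positivity)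
    refine (continuousOn_tsum (fun n => (hc n).continuousOn)
      (Real.summable_pow_div_factorial B) hB).continuousAt (Icc_mem_nhds ?_ ?_)
    · linarith [neg_abs_le x]
    · linarith [le_abs_self x]
  have hqz : ∀ a b : ℝ, IntervalIntegrable (fun t => q t * z t) volume a b := fun a b =>
    (hq a b).mul_continuousOn hzc.continuousOn
  have hint : ∀ x, z x = 1 + ∫ t in (0 : ℝ)..x, (x - t) * (q t * z t) := by
    intro x
    obtain ⟨B, hB⟩ := hb |x| (abs_nonneg x)
    have hsub : ∀ t ∈ uIoc (0 : ℝ) x, t ∈ Icc (-|x|) |x| := by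
      intro t ht
      rcases le_total 0 x with h | h
      · rw [uIoc_of_le h] at ht
        rw [abs_of_nonneg h]; exact ⟨by linarith [ht.1], ht.2⟩
      · rw [uIoc_of_ge h] at ht
        rw [abs_of_nonpos h]; exact ⟨by linarith [ht.1], by linarith [ht.2]⟩
    have hs1 : HasSum (fun n => ∫ t in (0 : ℝ)..x, (x - t) * (q t * picard q n t))
        (∫ t in (0 : ℝ)..x, (x - t) * (q t * z t)) := by
      refine intervalIntegral.hasSum_integral_of_dominated_convergence
        (fun n t => |(x - t) * q t| * (B ^ n / n.factorial)) (fun n => ?_) (fun n => ?_) ?_ ?_ ?_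
      · exact (((hq 0 x).mul_continuousOn (hc n).continuousOn).continuousOn_mul
          (by fun_prop : Continuous fun t : ℝ => x - t).continuousOn).def'.aestronglyMeasurable
      · refine Eventually.of_forall fun t ht => ?_
        rw [← mul_assoc, norm_mul, Real.norm_eq_abs]
        gcongr
        exact hB n t (hsub t ht)
      · exact Eventually.of_forall fun t _ => (Real.summable_pow_div_factorial B).mul_left _
      · simp_rw [tsum_mul_left]
        exact (((hq 0 x).continuousOn_mul
          (by fun_prop : Continuous fun t : ℝ => x - t).continuousOn).abs).mul_const _
      · refine Eventually.of_forall fun t _ => ?_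
        simpa [mul_assoc] using ((hsum t).mul_left ((x - t) * q t))
    have hs2 := (hasSum_nat_add_iff' 1).2 (hsum x)
    have := hs1.unique hs2
    simp only [Finset.sum_range_one] at this
    change _ = z x - 1 at this
    linarith
  have hz1 : ∀ x, 1 ≤ z x := by
    intro x
    exact (hsum x).summable.le_tsum 0 fun n _ => picard_nonneg hq0 n x
  have hp1 := prim_mul_iterated hqz
  have hp2 := IsPrim.of_intervalIntegrable hqz 0
  refine ⟨z, fun x => ∫ t in (0 : ℝ)..x, q t * z t, ⟨fun x => ?_, hp2⟩, ?_, by simp, hz1⟩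
  · have := (hp1.hasDerivAt hp2.continuous x).const_add 1
    exact this.congr_of_eventuallyEq (Eventually.of_forall hint)
  · rw [hint 0]; simp

/-- The solution of `w'' = q w` with `w(x₀) = 1`, `w'(x₀) = 0`. -/
theorem exists_cauchy (hq : ∀ a b : ℝ, IntervalIntegrable q volume a b)
    (hq0 : ∀ᵐ x : ℝ, 0 ≤ q x) (x₀ : ℝ) :
    ∃ w w' : ℝ → ℝ, IsHom q w w' ∧ w x₀ = 1 ∧ w' x₀ = 0 ∧ ∀ x, 1 ≤ w x := by
  have h1 : ∀ a b : ℝ, IntervalIntegrable (fun x => q (x + x₀)) volume a b := fun a b => by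
    simpa using (hq (a + x₀) (b + x₀)).comp_add_right x₀
  have h2 : ∀ᵐ x : ℝ, 0 ≤ q (x + x₀) :=
    (measurePreserving_add_right volume x₀).quasiMeasurePreserving.ae hq0
  obtain ⟨z, z', hz, h3, h4, h5⟩ := exists_cauchy_zero h1 h2
  refine ⟨fun x => z (x + -x₀), fun x => z' (x + -x₀), ⟨fun x => ?_, ?_⟩, by simpa using h3,
    by simpa using h4, fun x => h5 _⟩
  · exact (hz.hasDerivAt (x + -x₀)).comp_add_const x (-x₀)
  · simpa using hz.prim.comp_add_right (-x₀)

end Picard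

/-! ### Convexity and the length scale. -/

theorem sub_le_mul_of_monotone_deriv {P Q : ℝ → ℝ} (hP : ∀ x, HasDerivAt P (Q x) x)
    (hQ : Monotone Q) {a b : ℝ} (hab : a ≤ b) :
    (b - a) * Q a ≤ P b - P a ∧ P b - P a ≤ (b - a) * Q b := by
  rcases hab.eq_or_lt with rfl | hlt
  · simp
  obtain ⟨c, hc, hc'⟩ := exists_hasDerivAt_eq_slope P Q hlt
    (fun x _ => (hP x).continuousAt.continuousWithinAt) fun x _ => hP x
  have h0 : 0 < b - a := sub_pos.2 hlt
  have h1 : P b - P a = (b - a) * Q c := by rw [hc']; field_simp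
  rw [h1]
  exact ⟨mul_le_mul_of_nonneg_left (hQ hc.1.le) h0.le, mul_le_mul_of_nonneg_left (hQ hc.2.le) h0.le⟩

theorem increment_mono {P Q : ℝ → ℝ} (hP : ∀ x, HasDerivAt P (Q x) x)
    (hQ : Monotone Q) {h : ℝ} (hh : 0 ≤ h) {a b : ℝ} (hab : a ≤ b) :
    P (a + h) - P a ≤ P (b + h) - P b := by
  have hd : ∀ x, HasDerivAt (fun x => P (x + h) - P x) (Q (x + h) - Q x) x := fun x =>
    ((hP (x + h)).comp_add_const x h).sub (hP x)
  exact monotone_of_deriv_nonneg (fun x => (hd x).differentiableAt)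
    (fun x => by rw [(hd x).deriv]; exact sub_nonneg.2 (hQ (by linarith))) hab

/-- Otelbaev type length scale: `P'' ≥ 0` has second difference `2` at step `s`. -/
structure IsScale (P Q s : ℝ → ℝ) : Prop where
  hasDerivAt : ∀ x, HasDerivAt P (Q x) x
  mono : Monotone Q
  pos : ∀ x, 0 < s x
  eq : ∀ x, P (x + s x) + P (x - s x) - 2 * P x = 2

namespace IsScale

variable {P Q s : ℝ → ℝ}

theorem le_mul_of_le (h : IsScale P Q s) {x σ : ℝ} (hσ : 0 ≤ σ)
    (h2 : 2 ≤ P (x + σ) + P (x - σ) - 2 * P x) : 2 ≤ σ * (Q (x + σ) - Q (x - σ)) := by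
  have h3 := (sub_le_mul_of_monotone_deriv h.hasDerivAt h.mono (by linarith : x ≤ x + σ)).2
  have h4 := (sub_le_mul_of_monotone_deriv h.hasDerivAt h.mono (by linarith : x - σ ≤ x)).1
  nlinarith

theorem two_le (h : IsScale P Q s) (x : ℝ) : 2 ≤ s x * (Q (x + s x) - Q (x - s x)) :=
  h.le_mul_of_le (h.pos x).le (h.eq x).ge

theorem mass_pos (h : IsScale P Q s) (x : ℝ) : 0 < Q (x + s x) - Q (x - s x) := by
  have h1 := h.two_le x
  have h2 := h.pos x
  by_contra h3
  nlinarith [not_lt.1 h3]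

/-- The second difference is nondecreasing in the step, with rate at least the mass of the window,
and that mass is positive once the second difference reaches 2. -/
theorem le_of_le (h : IsScale P Q s) {y σ : ℝ} (hσ : 0 < σ)
    (h2 : 2 ≤ P (y + σ) + P (y - σ) - 2 * P y) : s y ≤ σ := by
  by_contra! hlt
  have h3 := h.le_mul_of_le hσ.le h2
  have h4 := (sub_le_mul_of_monotone_deriv h.hasDerivAt h.mono (by linarith : y + σ ≤ y + s y)).1
  have h5 := (sub_le_mul_of_monotone_deriv h.hasDerivAt h.mono (by linarith : y - s y ≤ y - σ)).2
  have h6 := h.eq y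
  have h7 : 0 < Q (y + σ) - Q (y - σ) := by
    by_contra h8
    nlinarith [not_lt.1 h8]
  nlinarith [mul_pos (sub_pos.2 hlt) h7]

/-- The second difference at `x` with step `σ` integrates `q` against the tent `(σ - |ξ - x|)⁺`. The
tent at `y` of height `s x + |y - x|` lies above the tent at `x` of height `s x`. The proof
expresses this through increments of the convex `P`. -/
theorem le_add (h : IsScale P Q s) (x y : ℝ) : s y ≤ s x + |y - x| := by
  have hs := h.pos x
  have he := h.eq x
  refine h.le_of_le (by positivity) ?_
  rcases le_total x y with hxy | hxy
  · obtain ⟨k, hk, rfl⟩ : ∃ k, 0 ≤ k ∧ y = x + k := ⟨y - x, by linarith, by ring⟩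
    rw [add_sub_cancel_left, abs_of_nonneg hk]
    have h1 := increment_mono h.hasDerivAt h.mono (by linarith : 0 ≤ 2 * k)
      (by linarith : x ≤ x + s x)
    have h2 := increment_mono h.hasDerivAt h.mono hk (by linarith : x ≤ x + k)
    rw [show x + k + (s x + k) = x + s x + 2 * k by ring,
      show x + k - (s x + k) = x - s x by ring]
    rw [show x + k + k = x + 2 * k by ring] at h2
    linarith
  · obtain ⟨k, hk, rfl⟩ : ∃ k, 0 ≤ k ∧ y = x - k := ⟨x - y, by linarith, by ring⟩
    rw [show x - k - x = -k by ring, abs_neg, abs_of_nonneg hk]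
    have h1 := increment_mono h.hasDerivAt h.mono (by linarith : 0 ≤ 2 * k)
      (by linarith : x - s x - 2 * k ≤ x - 2 * k)
    have h2 := increment_mono h.hasDerivAt h.mono hk (by linarith : x - 2 * k ≤ x - k)
    rw [show x - k + (s x + k) = x + s x by ring,
      show x - k - (s x + k) = x - s x - 2 * k by ring]
    rw [show x - 2 * k + k = x - k by ring, show x - k + k = x by ring] at h2
    rw [show x - s x - 2 * k + 2 * k = x - s x by ring, show x - 2 * k + 2 * k = x by ring] at h1
    linarith

theorem abs_sub_le (h : IsScale P Q s) (x y : ℝ) : |s y - s x| ≤ |y - x| := by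
  have h1 := h.le_add x y
  have h2 := h.le_add y x
  rw [abs_sub_comm x y] at h2
  exact abs_le.2 ⟨by linarith, by linarith⟩

theorem continuous (h : IsScale P Q s) : Continuous s := by
  refine (LipschitzWith.of_dist_le_mul (K := 1) fun x y => ?_).continuous
  simpa [Real.dist_eq] using h.abs_sub_le y x

/-- The derivative of the length scale. -/
noncomputable def slope (Q s : ℝ → ℝ) (x : ℝ) : ℝ :=
  -(Q (x + s x) - 2 * Q x + Q (x - s x)) / (Q (x + s x) - Q (x - s x))

/-- Implicit differentiation: subtract the defining equations at `y` and `x` and linearise `P` at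
`x` and `x ± s x`. The Lipschitz bound turns the errors into `o(y - x)`, and the coefficient of `s y
- s x` is the positive mass of the window. -/
theorem hasDerivAt_scale (h : IsScale P Q s) (x : ℝ) : HasDerivAt s (slope Q s x) x := by
  have hS : (fun y => s y - s x) =O[𝓝 x] fun y => y - x :=
    Asymptotics.IsBigO.of_bound 1 (Eventually.of_forall fun y => by
      simpa using h.abs_sub_le x y)
  have hI : (fun y : ℝ => y - x) =O[𝓝 x] fun y => y - x := Asymptotics.isBigO_refl _ _
  have hc : Tendsto s (𝓝 x) (𝓝 (s x)) := h.continuous.continuousAt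
  have hid : Tendsto (fun y : ℝ => y) (𝓝 x) (𝓝 x) := tendsto_id
  have h1 := ((hasDerivAt_iff_isLittleO.1 (h.hasDerivAt (x + s x))).comp_tendsto
    (hid.add hc)).trans_isBigO (k := fun y => y - x) (by
      refine (hI.add hS).congr_left fun y => ?_
      simp only [Function.comp]; ring)
  have h2 := ((hasDerivAt_iff_isLittleO.1 (h.hasDerivAt (x - s x))).comp_tendsto
    (hid.sub hc)).trans_isBigO (k := fun y => y - x) (by
      refine (hI.sub hS).congr_left fun y => ?_
      simp only [Function.comp]; ring)
  have h3 := (hasDerivAt_iff_isLittleO.1 (h.hasDerivAt x)).const_mul_left 2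
  have hm := h.mass_pos x
  rw [hasDerivAt_iff_isLittleO]
  refine (((h1.add h2).sub h3).const_mul_left (-(Q (x + s x) - Q (x - s x))⁻¹)).congr_left
    fun y => ?_
  have e1 := h.eq x
  have e2 := h.eq y
  simp only [Function.comp, smul_eq_mul, slope]
  field_simp
  linear_combination e1 - e2

theorem abs_slope_le_one (h : IsScale P Q s) (x : ℝ) : |slope Q s x| ≤ 1 := by
  have hm := h.mass_pos x
  have hs := h.pos x
  have h1 := h.mono (by linarith : x ≤ x + s x)
  have h2 := h.mono (by linarith : x - s x ≤ x)
  rw [slope, abs_div, abs_neg, abs_of_pos hm, div_le_one hm, abs_le]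
  constructor <;> linarith

theorem abs_slope_le (h : IsScale P Q s) (x : ℝ) :
    |slope Q s x| ≤ |s x * (Q (x + s x) - 2 * Q x + Q (x - s x))| / 2 := by
  have hm := h.mass_pos x
  have hs := h.pos x
  have h1 := h.two_le x
  rw [slope, abs_div, abs_neg, abs_of_pos hm, abs_mul, abs_of_pos hs, div_le_div_iff₀ hm two_pos]
  nlinarith [mul_le_mul_of_nonneg_left h1 (abs_nonneg (Q (x + s x) - 2 * Q x + Q (x - s x)))]

/-- Twice the left mass is the total mass minus the right-left imbalance; multiplied by `s`, these
are at least 2 and at most 1. -/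
theorem half_mass_left (h : IsScale P Q s) {x : ℝ}
    (hx : |s x * (Q (x + s x) - 2 * Q x + Q (x - s x))| ≤ 1) :
    1 ≤ 2 * s x * (Q x - Q (x - s x)) := by
  have h1 := h.two_le x
  have h2 := (abs_le.1 hx).2
  linarith

theorem half_mass_right (h : IsScale P Q s) {x : ℝ}
    (hx : |s x * (Q (x + s x) - 2 * Q x + Q (x - s x))| ≤ 1) :
    1 ≤ 2 * s x * (Q (x + s x) - Q x) := by
  have h1 := h.two_le x
  have h2 := (abs_le.1 hx).1
  linarith

/-- An upper bound for the mass of the half-size window. -/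
theorem mass_le (h : IsScale P Q s) (x : ℝ) :
    s x * (Q (x + s x / 2) - Q (x - s x / 2)) ≤ 4 := by
  have hs := h.pos x
  -- In tent form: the weight `(s - |ξ - x|)⁺` is at least `s / 2` on the half-size window, so `s /
  -- 2` times its mass is at most 2.
  have h1 := (sub_le_mul_of_monotone_deriv h.hasDerivAt h.mono
    (by linarith : x + s x / 2 ≤ x + s x)).1
  have h2 := (sub_le_mul_of_monotone_deriv h.hasDerivAt h.mono
    (by linarith : x - s x ≤ x - s x / 2)).2
  have h3 := (increment_mono h.hasDerivAt h.mono (by linarith : 0 ≤ s x / 2)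
    (by linarith : x - s x / 2 ≤ x))
  have h4 := h.eq x
  rw [show x - s x / 2 + s x / 2 = x by ring] at h3
  linarith

end IsScale

/-! ### The length scale attached to `q`. -/

section

variable {q : ℝ → ℝ}

theorem isScale (hq : LocallyIntegrable q volume) (hq0 : ∀ᵐ x : ℝ, 0 ≤ q x)
    (ht : PositiveTails q) :
    IsScale (fun x => ∫ r in (0 : ℝ)..x, ∫ t in (0 : ℝ)..r, q t)
      (fun x => ∫ t in (0 : ℝ)..x, q t) (fun x => Real.sqrt 2 * d q x) := by
  have hii : ∀ a b : ℝ, IntervalIntegrable q volume a b := fun a b =>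
    (hq.integrableOn_isCompact isCompact_uIcc).intervalIntegrable
  have hQ := IsPrim.of_intervalIntegrable hii 0
  have hQc := hQ.continuous
  set Q : ℝ → ℝ := fun x => ∫ t in (0 : ℝ)..x, q t with hQdef
  have hP := IsPrim.of_intervalIntegrable (fun a b => hQc.intervalIntegrable a b) 0
  refine ⟨fun x => hP.hasDerivAt hQc x, hQ.monotone hq0,
    fun x => mul_pos (by positivity) (d_spec hq hq0 ht x).1, fun x => ?_⟩
  have h1 := (d_spec hq hq0 ht x).2.1
  rw [F] at h1
  have h2 : ∀ t, ∫ ξ in (x - t)..(x + t), q ξ = Q (x + t) - Q (x - t) := fun t => hQ.2 _ _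
  simp_rw [h2] at h1
  rw [intervalIntegral.integral_sub, intervalIntegral.integral_comp_add_left,
    intervalIntegral.integral_comp_sub_left, hP.2, hP.2] at h1
  · simp only [add_zero, sub_zero] at h1
    linarith
  · exact (hQc.comp (by fun_prop : Continuous fun t => x + t)).intervalIntegrable _ _
  · exact (hQc.comp (by fun_prop : Continuous fun t => x - t)).intervalIntegrable _ _

theorem nu_eq (hq : LocallyIntegrable q volume) (x : ℝ) :
    Real.sqrt 2 * nu q x = Real.sqrt 2 * d q x * ((∫ t in (0 : ℝ)..(x + Real.sqrt 2 * d q x), q t) -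
      2 * (∫ t in (0 : ℝ)..x, q t) + ∫ t in (0 : ℝ)..(x - Real.sqrt 2 * d q x), q t) := by
  have hii : ∀ a b : ℝ, IntervalIntegrable q volume a b := fun a b =>
    (hq.integrableOn_isCompact isCompact_uIcc).intervalIntegrable
  have hQ := IsPrim.of_intervalIntegrable hii 0
  rw [nu, intervalIntegral.integral_sub, intervalIntegral.integral_comp_add_left,
    intervalIntegral.integral_comp_sub_left, hQ.2, hQ.2]
  · simp only [add_zero, sub_zero]
    ring
  · simpa [add_comm] using (hii (0 + x) (Real.sqrt 2 * d q x + x)).comp_add_right x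
  · simpa using (hii (x - 0) (x - Real.sqrt 2 * d q x)).comp_sub_left x

theorem qStar_eq (x : ℝ) : qStar q x = 2 / (Real.sqrt 2 * d q x) ^ 2 := by
  rw [qStar, mul_pow, Real.sq_sqrt (by norm_num)]
  rw [div_mul_eq_div_div]; norm_num

end

/-! ### Failure of admissibility without a weight. -/

theorem isSolution_of_isPrim {q f y y' g : ℝ → ℝ} (hy : ∀ x, HasDerivAt y (y' x) x)
    (hy' : IsPrim y' g) (h : ∀ᵐ x : ℝ, -g x + q x * y x = f x) : IsSolution q f y := by
  have hd : deriv y = y' := funext fun x => (hy x).deriv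
  refine ⟨fun x => (hy x).differentiableAt,
    (IsPrim.of_hasDerivAt hy hy'.continuous).absolutelyContinuous, ?_, ?_⟩
  · rw [hd]; exact hy'.absolutelyContinuous
  · rw [hd]
    filter_upwards [h, hy'.ae_hasDerivAt] with x h1 h2
    rw [h2.deriv, h1]

theorem IsSolution.isPrim {q f y : ℝ → ℝ} (h : IsSolution q f y) :
    (∀ x, HasDerivAt y (deriv y x) x) ∧ IsPrim (deriv y) (fun x => q x * y x - f x) := by
  refine ⟨fun x => (h.1 x).hasDerivAt,
    (IsPrim.of_absolutelyContinuous h.2.2.1).congr_ae (h.2.2.2.mono fun x hx => ?_)⟩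
  linarith

theorem exists_bump : ∃ φ φ' φ'' : ℝ → ℝ, ∃ C : ℝ, (∀ x, HasDerivAt φ (φ' x) x) ∧
    (∀ x, HasDerivAt φ' (φ'' x) x) ∧ Continuous φ'' ∧ (∀ x, |x| ≤ 1 / 2 → φ x = 1) ∧
    (∀ x, 1 < |x| → φ x = 0 ∧ φ' x = 0 ∧ φ'' x = 0) ∧ 0 < C ∧ (∀ x, |φ' x| ≤ C) ∧
    ∀ x, |φ'' x| ≤ C := by
  let b : ContDiffBump (0 : ℝ) := ⟨1 / 2, 1, by norm_num, by norm_num⟩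
  have h2 : ContDiff ℝ 2 b := b.contDiff
  have h1 : ContDiff ℝ 1 (deriv b) := by
    have : ContDiff ℝ (1 + 1) b := by simpa [one_add_one_eq_two] using h2
    exact (contDiff_succ_iff_deriv.1 this).2.2
  have hc : Continuous (deriv (deriv b)) := h1.continuous_deriv le_rfl
  have hs : HasCompactSupport b := b.hasCompactSupport
  obtain ⟨C1, hC1⟩ := hs.deriv.exists_bound_of_continuous h1.continuous
  obtain ⟨C2, hC2⟩ := hs.deriv.deriv.exists_bound_of_continuous hc
  refine ⟨b, deriv b, deriv (deriv b), max 1 (max C1 C2),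
    fun x => (h2.differentiable (by norm_num) x).hasDerivAt,
    fun x => (h1.differentiable (by norm_num) x).hasDerivAt, hc, fun x hx => ?_, fun x hx => ?_,
    by positivity, fun x => (hC1 x).trans (by simp), fun x => (hC2 x).trans (by simp)⟩
  · exact b.one_of_mem_closedBall (by simpa [b] using hx)
  · have hx' : x ∉ tsupport b := by
      rw [b.tsupport_eq]
      simpa [b] using hx
    refine ⟨image_eq_zero_of_notMem_tsupport hx', ?_, ?_⟩
    · exact image_eq_zero_of_notMem_tsupport fun h => hx' (tsupport_deriv_subset h)
    · exact image_eq_zero_of_notMem_tsupport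
        fun h => hx' (tsupport_deriv_subset (tsupport_deriv_subset h))

/-- On an interval of half-length `δ` carrying mass at most `1/(2δ)`, the solution with Cauchy data
`(1, 0)` at the midpoint and its derivative stay bounded. -/
theorem IsHom.bound_of_mass {q w w' : ℝ → ℝ} (hw : IsHom q w w')
    (hq : ∀ a b : ℝ, IntervalIntegrable q volume a b) (hq0 : ∀ᵐ x : ℝ, 0 ≤ q x)
    (h1 : ∀ x, 1 ≤ w x) {x₀ δ : ℝ} (hδ : 0 < δ) (hx : w x₀ = 1) (hx' : w' x₀ = 0)
    (hm : δ * ∫ t in (x₀ - δ)..(x₀ + δ), q t ≤ 1 / 2) {x : ℝ} (hxI : |x - x₀| ≤ δ) :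
    w x ≤ 2 ∧ |w' x| ≤ 1 / δ := by
  set m := ∫ t in (x₀ - δ)..(x₀ + δ), q t with hmdef
  have hI : ∀ {x}, |x - x₀| ≤ δ → x ∈ Icc (x₀ - δ) (x₀ + δ) := fun {x} h => by
    have := abs_le.1 h
    exact ⟨by linarith, by linarith⟩
  have hI' : ∀ {x}, x ∈ Icc (x₀ - δ) (x₀ + δ) → |x - x₀| ≤ δ := fun {x} h =>
    abs_le.2 ⟨by linarith [h.1], by linarith [h.2]⟩
  have h0I : x₀ ∈ Icc (x₀ - δ) (x₀ + δ) := ⟨by linarith, by linarith⟩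
  obtain ⟨xm, hxm, hmax⟩ := isCompact_Icc.exists_isMaxOn ⟨x₀, h0I⟩
    (hw.continuous.continuousOn (s := Icc (x₀ - δ) (x₀ + δ)))
  have hQ := IsPrim.of_intervalIntegrable hq 0
  have hmono := hQ.monotone hq0
  -- Bootstrap on the maximum of `w`: this bound gives `max w - 1 ≤ m δ max w ≤ max w / 2`.
  have hder : ∀ t ∈ Icc (x₀ - δ) (x₀ + δ), |w' t| ≤ m * w xm := by
    intro t ht
    have e1 : w' t = ∫ r in x₀..t, q r * w r := by rw [hw.prim.2, hx', sub_zero]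
    rw [e1]
    have e2 : ‖∫ r in x₀..t, q r * w r‖ ≤ |∫ r in x₀..t, q r * w xm| := by
      refine intervalIntegral.norm_integral_le_abs_of_norm_le ?_ ((hq _ _).mul_const _)
      filter_upwards [ae_restrict_of_ae hq0, ae_restrict_mem measurableSet_uIoc] with r h3 h4
      rw [norm_mul, Real.norm_of_nonneg h3, Real.norm_of_nonneg (by linarith [h1 r])]
      exact mul_le_mul_of_nonneg_left
        (hmax (uIcc_subset_Icc h0I ht (uIoc_subset_uIcc h4))) h3
    refine e2.trans ?_
    rw [intervalIntegral.integral_mul_const, abs_mul,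
      abs_of_nonneg (by linarith [h1 xm] : 0 ≤ w xm)]
    refine mul_le_mul_of_nonneg_right ?_ (by linarith [h1 xm])
    rw [hmdef, hQ.2, hQ.2, abs_le]
    have a1 := hmono ht.1
    have a2 := hmono ht.2
    have a3 := hmono h0I.1
    have a4 := hmono h0I.2
    constructor <;> linarith
  have hm0 : 0 ≤ m := intervalIntegral.integral_nonneg_of_ae (by linarith) hq0
  have hmax2 : w xm ≤ 2 := by
    have e1 : ‖∫ t in x₀..xm, w' t‖ ≤ (m * w xm) * |xm - x₀| :=
      intervalIntegral.norm_integral_le_of_norm_le_const fun t ht =>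
        hder t (uIcc_subset_Icc h0I hxm (uIoc_subset_uIcc ht))
    rw [hw.prim'.2, hx, Real.norm_eq_abs] at e1
    have e2 : (m * w xm) * |xm - x₀| ≤ (m * w xm) * δ :=
      mul_le_mul_of_nonneg_left (hI' hxm) (mul_nonneg hm0 (by linarith [h1 xm]))
    nlinarith [le_abs_self (w xm - 1), h1 xm]
  refine ⟨(hmax (hI hxI)).trans hmax2, (hder x (hI hxI)).trans ?_⟩
  rw [le_div_iff₀ hδ]
  nlinarith [h1 xm]

theorem memWeightedLp_one_of_compactSupport {g : ℝ → ℝ} (hg : Continuous g)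
    (hs : HasCompactSupport g) (p : ℝ≥0∞) : MemWeightedLp p (fun _ => 1) g := by
  have h : MemLp g p volume := hg.memLp_of_hasCompactSupport hs
  exact ⟨fun K _ => h.restrict K, by simpa using h⟩

/-- If the length scale is unbounded, then the pair `{L_p; L_p}` is not admissible. -/
theorem not_admissible_one {q : ℝ → ℝ} (hq : LocallyIntegrable q volume)
    (hq0 : ∀ᵐ x : ℝ, 0 ≤ q x) (ht : PositiveTails q) (hd : ∀ M : ℝ, ∃ x : ℝ, M < d q x)
    {p : ℝ≥0∞} (hp : 1 ≤ p) (hp' : p < ∞) : ¬ Admissible q p (fun _ => 1) (fun _ => 1) := by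
  rintro ⟨-, -, -, c, hc, hbound⟩
  have hii : ∀ a b : ℝ, IntervalIntegrable q volume a b := fun a b =>
    (hq.integrableOn_isCompact isCompact_uIcc).intervalIntegrable
  obtain ⟨φ, φ', φ'', C, hφ, hφ', hφ'', hφ1, hφ0, hC, hC1, hC2⟩ := exists_bump
  -- Here `δ² = d² / 32`, so this choice gives `δ² > 8 c C`, the threshold in the final
  -- contradiction.
  obtain ⟨x₀, hx₀⟩ := hd (256 * c * C + 1)
  have hs := isScale hq hq0 ht
  have hmass := hs.mass_le x₀
  set δ : ℝ := Real.sqrt 2 * d q x₀ / 8 with hδdef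
  have hδ : 0 < δ := by have := hs.pos x₀; positivity
  have hδ2 : 8 * c * C < δ ^ 2 := by
    rw [hδdef, div_pow, mul_pow, Real.sq_sqrt (by norm_num)]
    have : 0 < c * C := by positivity
    nlinarith
  have hm : δ * ∫ t in (x₀ - δ)..(x₀ + δ), q t ≤ 1 / 2 := by
    have hQ := IsPrim.of_intervalIntegrable hii 0
    have hmono := hQ.monotone hq0
    rw [hQ.2]
    have e1 := hmono (by linarith : x₀ + δ ≤ x₀ + Real.sqrt 2 * d q x₀ / 2)
    have e2 := hmono (by linarith : x₀ - Real.sqrt 2 * d q x₀ / 2 ≤ x₀ - δ)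
    have e3 : Real.sqrt 2 * d q x₀ = 8 * δ := by rw [hδdef]; ring
    simp only [e3] at *
    nlinarith
  obtain ⟨w, w', hw, hwx, hwx', hw1⟩ := exists_cauchy hii hq0 x₀
  have hwb : ∀ {x}, |x - x₀| ≤ δ → w x ≤ 2 ∧ |w' x| ≤ 1 / δ := fun {x} hx =>
    hw.bound_of_mass hii hq0 hw1 hδ hwx hwx' hm hx
  have hl : ∀ x, HasDerivAt (fun x : ℝ => (x - x₀) / δ) (1 / δ) x := fun x =>
    ((hasDerivAt_id x).sub_const x₀).div_const δ
  have hlc : Continuous fun x : ℝ => (x - x₀) / δ := by fun_prop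
  have hd1 : ∀ x, HasDerivAt (fun x => φ ((x - x₀) / δ)) (φ' ((x - x₀) / δ) * (1 / δ)) x :=
    fun x => (hφ _).comp x (hl x)
  have hd2 : ∀ x, HasDerivAt (fun x => φ' ((x - x₀) / δ)) (φ'' ((x - x₀) / δ) * (1 / δ)) x :=
    fun x => (hφ' _).comp x (hl x)
  have hφc : Continuous φ := continuous_iff_continuousAt.2 fun x => (hφ x).continuousAt
  have hφc' : Continuous φ' := continuous_iff_continuousAt.2 fun x => (hφ' x).continuousAt
  have hp1 := IsPrim.of_hasDerivAt hd1 (by fun_prop)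
  have hp2 := IsPrim.of_hasDerivAt hd2 (by fun_prop)
  -- In `-y'' + q y` the terms containing the undifferentiated cutoff cancel, so `f` contains no `q`
  -- and is continuous.
  set y : ℝ → ℝ := fun x => φ ((x - x₀) / δ) * w x with hy
  set f : ℝ → ℝ := fun x => -(φ'' ((x - x₀) / δ) * (1 / δ) * (1 / δ) * w x +
    2 * (φ' ((x - x₀) / δ) * (1 / δ)) * w' x) with hf
  have hwc := hw.continuous
  have hwc' := hw.prim.continuous
  have hyc : Continuous y := by fun_prop
  have hfc : Continuous f := by fun_prop
  have hout : ∀ x, x ∉ Icc (x₀ - δ) (x₀ + δ) → 1 < |(x - x₀) / δ| := by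
    intro x hx
    rw [abs_div, abs_of_pos hδ, lt_div_iff₀ hδ, one_mul]
    by_contra! h
    exact hx ⟨by linarith [(abs_le.1 h).1], by linarith [(abs_le.1 h).2]⟩
  have hys : HasCompactSupport y :=
    HasCompactSupport.intro (K := Icc (x₀ - δ) (x₀ + δ)) isCompact_Icc fun x hx => by
    simp [hy, hφ0 _ (hout x hx)]
  have hf0 : ∀ x, x ∉ Icc (x₀ - δ) (x₀ + δ) → f x = 0 := fun x hx => by
    simp [hf, hφ0 _ (hout x hx)]
  have hfs : HasCompactSupport f := HasCompactSupport.intro isCompact_Icc hf0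
  have hsol : IsSolution q f y := by
    refine isSolution_of_isPrim (fun x => (hd1 x).mul (hw.hasDerivAt x))
      (((hp2.mul hw.prim').const_mul (1 / δ)).add (hp1.mul hw.prim) |> fun h => ?_)
      (Eventually.of_forall fun x => ?_) (g := fun x => 1 / δ * (φ'' ((x - x₀) / δ) * (1 / δ) * w x +
        φ' ((x - x₀) / δ) * w' x) + (φ' ((x - x₀) / δ) * (1 / δ) * w' x +
        φ ((x - x₀) / δ) * (q x * w x)))
    · convert h using 2
      ring
    · simp only [hy, hf]; ring
  have key := hbound f y (memWeightedLp_one_of_compactSupport hfc hfs p) hsol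
    (memWeightedLp_one_of_compactSupport hyc hys p)
  simp only [weightedNorm, one_mul] at key
  have hp0 : p ≠ 0 := (zero_lt_one.trans_le hp).ne'
  have hfle : eLpNorm f p volume ≤ ENNReal.ofReal (4 * C / δ ^ 2) *
      ENNReal.ofReal (2 * δ) ^ (1 / p.toReal) := by
    have e1 : eLpNorm f p volume ≤ eLpNorm
        ((Icc (x₀ - δ) (x₀ + δ)).indicator fun _ => 4 * C / δ ^ 2) p volume := by
      refine eLpNorm_mono_real fun x => ?_
      by_cases hx : x ∈ Icc (x₀ - δ) (x₀ + δ)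
      · rw [indicator_of_mem hx]
        obtain ⟨b1, b2⟩ := hwb (abs_le.2 ⟨by linarith [hx.1], by linarith [hx.2]⟩ : |x - x₀| ≤ δ)
        have b3 : |w x| ≤ 2 := by rwa [abs_of_nonneg (by linarith [hw1 x])]
        rw [hf, norm_neg]
        refine (norm_add_le _ _).trans ?_
        simp only [norm_mul, Real.norm_eq_abs, abs_of_pos (one_div_pos.2 hδ), Nat.abs_ofNat]
        calc |φ'' ((x - x₀) / δ)| * (1 / δ) * (1 / δ) * |w x| +
              2 * (|φ' ((x - x₀) / δ)| * (1 / δ)) * |w' x|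
            ≤ C * (1 / δ) * (1 / δ) * 2 + 2 * (C * (1 / δ)) * (1 / δ) := by
              gcongr
              · exact hC2 _
              · exact hC1 _
          _ = 4 * C / δ ^ 2 := by field_simp; ring
      · rw [indicator_of_notMem hx, hf0 x hx, norm_zero]
    refine e1.trans (le_of_eq ?_)
    rw [eLpNorm_indicator_const measurableSet_Icc hp0 hp'.ne, Real.volume_Icc,
      Real.enorm_of_nonneg (by positivity), show x₀ + δ - (x₀ - δ) = 2 * δ by ring]
  have hyle : ENNReal.ofReal δ ^ (1 / p.toReal) ≤ eLpNorm y p volume := by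
    have e1 : eLpNorm ((Icc (x₀ - δ / 2) (x₀ + δ / 2)).indicator fun _ => (1 : ℝ)) p volume ≤
        eLpNorm y p volume := by
      refine eLpNorm_mono fun x => ?_
      by_cases hx : x ∈ Icc (x₀ - δ / 2) (x₀ + δ / 2)
      · have : φ ((x - x₀) / δ) = 1 := by
          apply hφ1
          rw [abs_div, abs_of_pos hδ, div_le_iff₀ hδ, abs_le]
          constructor <;> linarith [hx.1, hx.2]
        rw [indicator_of_mem hx, hy]
        simp only [this, one_mul, norm_one]
        exact (hw1 x).trans (le_abs_self _)
      · simp [indicator_of_notMem hx]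
    refine le_trans (le_of_eq ?_) e1
    rw [eLpNorm_indicator_const measurableSet_Icc hp0 hp'.ne, Real.volume_Icc,
      enorm_one, one_mul, show x₀ + δ / 2 - (x₀ - δ / 2) = δ by ring]
  have hp1' : 1 / p.toReal ≤ 1 := by
    have : 1 ≤ p.toReal := by
      rw [← ENNReal.toReal_one]; exact ENNReal.toReal_mono hp'.ne hp
    exact (div_le_one (by linarith)).2 this
  -- The support of `f` has length `2 δ`; since `p ≥ 1`, the factor `2 ^ (1 / p)` is at most 2, and
  -- the total constant is `8 c C / δ² < 1`.
  have h3 : ENNReal.ofReal δ ^ (1 / p.toReal) ≤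
      ENNReal.ofReal (c * (4 * C / δ ^ 2) * 2) * ENNReal.ofReal δ ^ (1 / p.toReal) := by
    refine (hyle.trans key).trans ((mul_le_mul_right hfle _).trans ?_)
    rw [ENNReal.ofReal_mul two_pos.le, ENNReal.mul_rpow_of_nonneg _ _ (by positivity),
      ENNReal.ofReal_mul (by positivity), ENNReal.ofReal_mul hc.le, ← mul_assoc, ← mul_assoc]
    gcongr
    rw [ENNReal.ofReal_ofNat]
    calc (2 : ℝ≥0∞) ^ (1 / p.toReal) ≤ 2 ^ (1 : ℝ) :=
          ENNReal.rpow_le_rpow_of_exponent_le (by norm_num) hp1'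
      _ = 2 := by simp
  have hpos : ENNReal.ofReal δ ^ (1 / p.toReal) ≠ 0 := by
    simp [hδ]
  have hfin : ENNReal.ofReal δ ^ (1 / p.toReal) ≠ ∞ :=
    ENNReal.rpow_ne_top_of_nonneg (by positivity) ENNReal.ofReal_ne_top
  have h4 : ENNReal.ofReal (c * (4 * C / δ ^ 2) * 2) < 1 := by
    rw [ENNReal.ofReal_lt_one]
    rw [show c * (4 * C / δ ^ 2) * 2 = 8 * c * C / δ ^ 2 by ring, div_lt_one (by positivity)]
    exact hδ2
  have h5 := ENNReal.mul_lt_mul_left hpos hfin h4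
  rw [one_mul] at h5
  exact absurd h3 (not_le.2 h5)

/-! ### Tail integrals and the principal solution. -/

/-- Integrate `g ≤ h'` over `[a, x]` and drop `h a ≥ 0`: the bound is uniform in `a`, so it yields
integrability as well as the estimate. -/
theorem integral_Iic_le {g h h' : ℝ → ℝ} {x : ℝ} (hg : Continuous g)
    (hd : ∀ t ≤ x, HasDerivAt h (h' t) t) (h0 : ∀ t ≤ x, 0 ≤ h t) (hg0 : ∀ t ≤ x, 0 ≤ g t)
    (hgh : ∀ t ≤ x, g t ≤ h' t) : IntegrableOn g (Iic x) ∧ ∫ t in Iic x, g t ≤ h x := by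
  have h1 : ∀ a ≤ x, ∫ t in a..x, g t ≤ h x := by
    intro a ha
    have := intervalIntegral.integral_le_sub_of_hasDeriv_right_of_le ha
      (fun t ht => (hd t ht.2).continuousAt.continuousWithinAt)
      (fun t ht => (hd t ht.2.le).hasDerivWithinAt)
      (hg.integrableOn_Icc) (fun t ht => hgh t ht.2.le)
    linarith [h0 a ha]
  have h2 : IntegrableOn g (Iic x) := by
    refine integrableOn_Iic_of_intervalIntegral_norm_bounded (l := atBot) (a := id) (h x) x
      (fun a => hg.integrableOn_Ioc) tendsto_id ?_
    filter_upwards [eventually_le_atBot x] with a ha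
    refine le_trans (le_of_eq ?_) (h1 a ha)
    refine intervalIntegral.integral_congr fun t ht => ?_
    rw [id, uIcc_of_le ha] at ht
    exact Real.norm_of_nonneg (hg0 t ht.2)
  refine ⟨h2, le_of_tendsto (intervalIntegral_tendsto_integral_Iic x h2 tendsto_id) ?_⟩
  filter_upwards [eventually_le_atBot x] with a ha
  exact h1 a ha

theorem lintegral_Iic_le {g h h' : ℝ → ℝ} {x : ℝ} (hg : Continuous g)
    (hd : ∀ t ≤ x, HasDerivAt h (h' t) t) (h0 : ∀ t ≤ x, 0 ≤ h t) (hg0 : ∀ t ≤ x, 0 ≤ g t)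
    (hgh : ∀ t ≤ x, g t ≤ h' t) :
    ∫⁻ t in Iic x, ENNReal.ofReal (g t) ≤ ENNReal.ofReal (h x) := by
  obtain ⟨h1, h2⟩ := integral_Iic_le hg hd h0 hg0 hgh
  rw [← ofReal_integral_eq_lintegral_ofReal h1
    ((ae_restrict_mem measurableSet_Iic).mono fun t ht => hg0 t ht)]
  exact ENNReal.ofReal_le_ofReal h2

/-- `q` has positive mass near `-∞`. -/
def LeftTail (q : ℝ → ℝ) : Prop := ∀ c : ℝ, ∃ a < c, 0 < ∫ t in a..c, q t

section

variable {q : ℝ → ℝ}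

theorem exists_mass_of_lintegral_pos (hq : ∀ a b : ℝ, IntervalIntegrable q volume a b)
    (hq0 : ∀ᵐ x : ℝ, 0 ≤ q x) {S : Set ℝ} {a b : ℕ → ℝ} (hab : ∀ n, a n ≤ b n)
    (hS : S ⊆ ⋃ n, Icc (a n) (b n)) (h : 0 < ∫⁻ t in S, ENNReal.ofReal (q t)) :
    ∃ n, 0 < ∫ t in (a n)..(b n), q t := by
  by_contra! hcon
  have h1 : ∀ n, ∫⁻ t in Icc (a n) (b n), ENNReal.ofReal (q t) = 0 := by
    intro n
    rw [← ofReal_integral_eq_lintegral_ofReal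
      ((intervalIntegrable_iff_integrableOn_Icc_of_le (hab n)).1 (hq _ _))
      (ae_restrict_of_ae hq0), ENNReal.ofReal_eq_zero, integral_Icc_eq_integral_Ioc,
      ← intervalIntegral.integral_of_le (hab n)]
    exact hcon n
  have h2 := (lintegral_mono_set (μ := volume) hS).trans (lintegral_iUnion_le _ fun t => ENNReal.ofReal (q t))
  simp [h1] at h2
  exact h.ne' h2

theorem leftTail (hq : ∀ a b : ℝ, IntervalIntegrable q volume a b)
    (hq0 : ∀ᵐ x : ℝ, 0 ≤ q x) (ht : PositiveTails q) : LeftTail q := by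
  intro c
  -- The shift by 1 keeps the left endpoint strictly below `c` even for `n = 0`.
  obtain ⟨n, hn⟩ := exists_mass_of_lintegral_pos hq hq0 (a := fun n => c - (n + 1))
    (b := fun _ => c) (fun n => by have : (0 : ℝ) ≤ n := n.cast_nonneg; linarith)
    (fun t ht => by
      obtain ⟨n, hn⟩ := exists_nat_ge (c - t)
      exact mem_iUnion.2 ⟨n, by linarith, ht⟩) (ht c).1
  exact ⟨_, by have : (0 : ℝ) ≤ n := n.cast_nonneg; linarith, hn⟩

theorem leftTail_comp_neg (hq : ∀ a b : ℝ, IntervalIntegrable q volume a b)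
    (hq0 : ∀ᵐ x : ℝ, 0 ≤ q x) (ht : PositiveTails q) : LeftTail fun x => q (-x) := by
  intro c
  obtain ⟨n, hn⟩ := exists_mass_of_lintegral_pos hq hq0 (a := fun _ => -c)
    (b := fun n => -c + (n + 1)) (fun n => by have : (0 : ℝ) ≤ n := n.cast_nonneg; linarith)
    (fun t ht => by
      obtain ⟨n, hn⟩ := exists_nat_ge (t + c)
      exact mem_iUnion.2 ⟨n, ht, by linarith⟩) (ht (-c)).2
  refine ⟨c - (n + 1), by have : (0 : ℝ) ≤ n := n.cast_nonneg; linarith, ?_⟩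
  rw [intervalIntegral.integral_comp_neg]
  rwa [show -(c - ((n : ℝ) + 1)) = -c + (n + 1) by ring]

theorem IsHom.monotone_deriv {u u' : ℝ → ℝ} (hu : IsHom q u u') (hq0 : ∀ᵐ x : ℝ, 0 ≤ q x)
    (h0 : ∀ x, 0 ≤ u x) : Monotone u' :=
  hu.prim.monotone (hq0.mono fun x hx => mul_nonneg hx (h0 x))

/-- On an interval where the solution is at least `m`, its derivative increases at least by
`m ∫ q`. -/
theorem IsHom.mul_mass_le {u u' : ℝ → ℝ} (hu : IsHom q u u')
    (hq : ∀ a b : ℝ, IntervalIntegrable q volume a b) (hq0 : ∀ᵐ x : ℝ, 0 ≤ q x) {a b m : ℝ}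
    (hab : a ≤ b) (hm : ∀ t ∈ Icc a b, m ≤ u t) : m * ∫ t in a..b, q t ≤ u' b - u' a := by
  rw [← hu.prim.2, ← intervalIntegral.integral_const_mul]
  refine intervalIntegral.integral_mono_ae_restrict hab ((hq a b).const_mul m) (hu.prim.1 a b) ?_
  filter_upwards [ae_restrict_of_ae hq0, ae_restrict_mem measurableSet_Icc] with t h1 h2
  nlinarith [mul_le_mul_of_nonneg_left (hm t h2) h1]

/-- The principal solution at `-∞`: positive and increasing. -/
theorem exists_principal (hq : ∀ a b : ℝ, IntervalIntegrable q volume a b)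
    (hq0 : ∀ᵐ x : ℝ, 0 ≤ q x) (ht : LeftTail q) :
    ∃ u u' : ℝ → ℝ, IsHom q u u' ∧ (∀ x, 0 < u x) ∧ ∀ x, 0 < u' x := by
  obtain ⟨z, z', hz, hz0, hz'0, hz1⟩ := exists_cauchy_zero hq hq0
  have hzpos : ∀ x, 0 < z x := fun x => zero_lt_one.trans_le (hz1 x)
  have hmono := hz.monotone_deriv hq0 fun x => (hzpos x).le
  have hzc := hz.continuous
  have hgc : Continuous fun t => 1 / z t ^ 2 :=
    continuous_const.div (hzc.pow 2) fun x => (pow_pos (hzpos x) 2).ne'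
  have hinv : ∀ t, HasDerivAt (fun t => 1 / z t) (-z' t / z t ^ 2) t := fun t => by
    simpa only [one_div] using! (hz.hasDerivAt t).inv (hzpos t).ne'
  -- Convexity keeps `z'` below `z' x < 0` to the left of `x`, so `1 / z²` is dominated by the
  -- derivative of `1 / (-z' x) * (1 / z)`.
  have htail : ∀ x, z' x < 0 → IntegrableOn (fun t => 1 / z t ^ 2) (Iic x) ∧
      ∫ t in Iic x, 1 / z t ^ 2 ≤ 1 / (-z' x) * (1 / z x) := by
    intro x hx
    have hx' : 0 < -z' x := neg_pos.2 hx
    refine integral_Iic_le (h := fun t => 1 / (-z' x) * (1 / z t)) hgc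
      (fun t _ => (hinv t).const_mul _) (fun t _ => ?_) (fun t _ => ?_) (fun t ht => ?_)
    · have := hzpos t; positivity
    · have := hzpos t; positivity
    · have h1 : -z' x ≤ -z' t := neg_le_neg (hmono ht)
      have h2 : 0 < z t ^ 2 := pow_pos (hzpos t) 2
      rw [div_mul_div_comm, one_mul]
      rw [div_le_div_iff₀ h2 (by positivity)]
      nlinarith
  obtain ⟨x₁, hx₁, hmass⟩ := ht 0
  have hx₁' : z' x₁ < 0 := by
    have := hz.mul_mass_le hq hq0 hx₁.le fun t _ => hz1 t
    rw [hz'0] at this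
    linarith
  have hint : ∀ x, IntegrableOn (fun t => 1 / z t ^ 2) (Iic x) := by
    intro x
    have h1 : IntegrableOn (fun t => 1 / z t ^ 2) (Iic x₁ ∪ Icc x₁ x) :=
      (htail x₁ hx₁').1.union hgc.integrableOn_Icc
    refine h1.mono_set fun t ht => ?_
    rcases le_total t x₁ with h | h
    · exact Or.inl h
    · exact Or.inr ⟨h, ht⟩
  -- Reduction of order: the second solution `z A` has derivative `z' A + 1 / z`. Where `z' < 0`,
  -- the tail bound on `A` makes this nonnegative.
  set A : ℝ → ℝ := fun x => ∫ t in Iic x, 1 / z t ^ 2 with hA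
  have hAp : IsPrim A fun t => 1 / z t ^ 2 :=
    ⟨fun a b => hgc.intervalIntegrable a b, fun a b =>
      (intervalIntegral.integral_Iic_sub_Iic (hint a) (hint b)).symm⟩
  have hA0 : ∀ x, 0 < A x := by
    intro x
    have h1 : 0 ≤ A (x - 1) := setIntegral_nonneg measurableSet_Iic fun t _ => by positivity
    have h2 := hAp.2 (x - 1) x
    have h3 : 0 < ∫ t in (x - 1)..x, 1 / z t ^ 2 :=
      intervalIntegral.intervalIntegral_pos_of_pos (hgc.intervalIntegrable _ _)
        (fun t => by have := hzpos t; positivity) (by linarith)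
    linarith
  have hhom : IsHom q (fun x => z x * A x) (fun x => z' x * A x + 1 / z x) := by
    refine ⟨fun x => ?_, ?_⟩
    · refine ((hz.hasDerivAt x).mul (hAp.hasDerivAt hgc x)).congr_deriv ?_
      have := (hzpos x).ne'
      field_simp
    · have h1 := hz.prim.mul hAp
      have h2 : IsPrim (fun t => 1 / z t) fun t => -z' t / z t ^ 2 :=
        IsPrim.of_hasDerivAt hinv (hz.prim.continuous.neg.div (hzc.pow 2)
          fun x => (pow_pos (hzpos x) 2).ne')
      refine (h1.add h2).congr_ae (Eventually.of_forall fun x => ?_)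
      have := (hzpos x).ne'
      field_simp
      ring
  have hpos : ∀ x, 0 < z x * A x := fun x => mul_pos (hzpos x) (hA0 x)
  have hnn : ∀ x, 0 ≤ z' x * A x + 1 / z x := by
    intro x
    have hzx := hzpos x
    rcases lt_or_ge (z' x) 0 with h | h
    · have h1 := (htail x h).2
      have h2 : -z' x * A x ≤ -z' x * (1 / (-z' x) * (1 / z x)) :=
        mul_le_mul_of_nonneg_left h1 (by linarith)
      have h3 : -z' x * (1 / (-z' x) * (1 / z x)) = 1 / z x := by
        rw [← mul_assoc, mul_one_div_cancel (by linarith), one_mul]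
      linarith
    · have := hA0 x; positivity
  have hum : Monotone fun x => z x * A x :=
    monotone_of_deriv_nonneg (fun x => (hhom.hasDerivAt x).differentiableAt)
      fun x => by rw [(hhom.hasDerivAt x).deriv]; exact hnn x
  refine ⟨_, _, hhom, hpos, fun x => ?_⟩
  -- Strict positivity of the derivative comes from mass to the left of `x`, over which it has
  -- already increased.
  obtain ⟨a, ha, hm⟩ := ht x
  have h1 := hhom.mul_mass_le hq hq0 ha.le fun t ht => hum ht.1
  have h2 := mul_pos (hpos a) hm
  have h3 := hnn a
  simp only at h1 h2
  linarith

/-- The mass gives `u' x ≥ u (x - s) / (2 s)`, and convexity gives `u x ≤ u (x - s) + s u' x`;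
together these give the factor `2 + 1`. -/
theorem IsHom.le_three_mul {u u' : ℝ → ℝ} (hu : IsHom q u u')
    (hq : ∀ a b : ℝ, IntervalIntegrable q volume a b) (hq0 : ∀ᵐ x : ℝ, 0 ≤ q x)
    (h0 : ∀ x, 0 < u x) (h1 : ∀ x, 0 < u' x) {x s : ℝ} (hs : 0 < s)
    (hm : 1 ≤ 2 * s * ∫ t in (x - s)..x, q t) : u x ≤ 3 * (s * u' x) := by
  have hmono := hu.monotone_deriv hq0 fun x => (h0 x).le
  have hum : Monotone u :=
    monotone_of_deriv_nonneg (fun x => (hu.hasDerivAt x).differentiableAt)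
      fun x => by rw [(hu.hasDerivAt x).deriv]; exact (h1 x).le
  have h2 := (sub_le_mul_of_monotone_deriv hu.hasDerivAt hmono (by linarith : x - s ≤ x)).2
  have h3 := hu.mul_mass_le hq hq0 (by linarith : x - s ≤ x) fun t ht => hum ht.1
  have h4 := h1 (x - s)
  have h5 := mul_le_mul_of_nonneg_left hm (h0 (x - s)).le
  nlinarith

end

/-! ### Growth at the length scale. -/

/-- Data for exponential growth of `u` at the length scale `s`. -/
structure IsGrowth (u u' s s' : ℝ → ℝ) (κ R : ℝ) : Prop where
  hasDerivAt : ∀ x, HasDerivAt u (u' x) x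
  pos : ∀ x, 0 < u x
  scale_hasDerivAt : ∀ x, HasDerivAt s (s' x) x
  scale_pos : ∀ x, 0 < s x
  slope_le_one : ∀ x, |s' x| ≤ 1
  rate_pos : 0 < κ
  growth : ∀ x, κ * u x ≤ s x * u' x
  slope_le : ∀ x, R ≤ |x| → |s' x| ≤ κ / 4

namespace IsGrowth

variable {u u' s s' : ℝ → ℝ} {κ R : ℝ}

/-- For `|x| ≤ R` the slope of `s` may exceed `κ`. A bounded factor `E = exp (L (arctan x + π / 2))`
compensates: `s E' / E = L s / (1 + x²)` is at least 1 there when `L` is large, and nonnegative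
everywhere. -/
theorem exists_damping (h : IsGrowth u u' s s' κ R) : ∃ E E' : ℝ → ℝ, ∃ B : ℝ, 0 < B ∧
    (∀ x, HasDerivAt E (E' x) x) ∧ (∀ x, 1 ≤ E x) ∧ (∀ x, E x ≤ B) ∧
    ∀ x, E x * (κ / 2) ≤ E x * κ - E x * |s' x| + s x * E' x := by
  have hsc : Continuous s := continuous_iff_continuousAt.2 fun x =>
    (h.scale_hasDerivAt x).continuousAt
  obtain ⟨K, hK⟩ := (isCompact_Icc (a := -R) (b := R)).exists_bound_of_continuousOn
    (f := fun x => (1 + x ^ 2) / s x) ((by fun_prop : Continuous fun x : ℝ => 1 + x ^ 2).div hsc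
      fun x => (h.scale_pos x).ne').continuousOn
  set L := max K 0 with hL
  have hL0 : 0 ≤ L := le_max_right _ _
  refine ⟨fun x => Real.exp (L * (Real.arctan x + Real.pi / 2)),
    fun x => Real.exp (L * (Real.arctan x + Real.pi / 2)) * (L * (1 / (1 + x ^ 2))),
    Real.exp (L * (Real.pi / 2 + Real.pi / 2)), Real.exp_pos _, fun x => ?_, fun x => ?_,
    fun x => ?_, fun x => ?_⟩
  · exact (((Real.hasDerivAt_arctan x).add_const _).const_mul L).exp
  · rw [Real.one_le_exp_iff]
    exact mul_nonneg hL0 (by linarith [Real.neg_pi_div_two_lt_arctan x])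
  · rw [Real.exp_le_exp]
    exact mul_le_mul_of_nonneg_left (by linarith [Real.arctan_lt_pi_div_two x]) hL0
  · have hE := Real.exp_pos (L * (Real.arctan x + Real.pi / 2))
    have hs := h.scale_pos x
    have hp : 0 < 1 + x ^ 2 := by positivity
    have hκ := h.rate_pos
    suffices hh : κ / 2 ≤ κ - |s' x| + s x * (L * (1 / (1 + x ^ 2))) by
      nlinarith [mul_le_mul_of_nonneg_left hh hE.le]
    rcases le_total R |x| with hx | hx
    · have h1 := h.slope_le x hx
      have : 0 ≤ s x * (L * (1 / (1 + x ^ 2))) := by positivity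
      linarith
    · have h1 := h.slope_le_one x
      have h2 : (1 + x ^ 2) / s x ≤ L :=
        (le_abs_self _).trans ((hK x (abs_le.1 hx)).trans (le_max_left _ _))
      have h3 : 1 ≤ s x * (L * (1 / (1 + x ^ 2))) := by
        rw [div_le_iff₀ hs] at h2
        rw [mul_one_div, ← mul_div_assoc, le_div_iff₀ hp]
        linarith
      linarith

/-- The functions `u s E` and `u E / s`, times `2 / κ`, have derivatives dominating `u` and `u /
s²`. The bounds `1 ≤ E ≤ B` then remove `E`. -/
theorem exists_lintegral_le (h : IsGrowth u u' s s' κ R) : ∃ C : ℝ, 0 < C ∧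
    (∀ x, ∫⁻ t in Iic x, ENNReal.ofReal (u t) ≤ ENNReal.ofReal (C * (u x * s x))) ∧
    ∀ x, ∫⁻ t in Iic x, ENNReal.ofReal (u t / s t ^ 2) ≤ ENNReal.ofReal (C * (u x / s x)) := by
  obtain ⟨E, E', B, hB, hE, hE1, hEB, hkey⟩ := h.exists_damping
  have hκ := h.rate_pos
  have huc : Continuous u := continuous_iff_continuousAt.2 fun x => (h.hasDerivAt x).continuousAt
  have hsc : Continuous s := continuous_iff_continuousAt.2 fun x =>
    (h.scale_hasDerivAt x).continuousAt
  have hE0 : ∀ x, 0 < E x := fun x => zero_lt_one.trans_le (hE1 x)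
  refine ⟨2 / κ * B, by positivity, fun x => ?_, fun x => ?_⟩
  · refine (lintegral_Iic_le (h := fun t => 2 / κ * (u t * s t * E t)) huc
      (fun t _ => (((h.hasDerivAt t).mul (h.scale_hasDerivAt t)).mul (hE t)).const_mul (2 / κ))
      (fun t _ => ?_) (fun t _ => (h.pos t).le) (fun t _ => ?_)).trans
      (ENNReal.ofReal_le_ofReal ?_)
    · have := h.pos t; have := h.scale_pos t; have := hE0 t; positivity
    · have h1 := h.growth t
      have h2 := (abs_le.1 (le_refl |s' t|)).1
      have h3 := mul_le_mul_of_nonneg_left (hkey t) (h.pos t).le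
      have h4 := mul_le_mul_of_nonneg_right h1 (hE0 t).le
      have h5 := mul_le_mul_of_nonneg_left h2 (mul_pos (h.pos t) (hE0 t)).le
      have h6 := mul_le_mul_of_nonneg_left (hE1 t) (h.pos t).le
      have h7 : κ / 2 * u t ≤ (u' t * s t + u t * s' t) * E t + u t * s t * E' t := by nlinarith
      calc u t = 2 / κ * (κ / 2 * u t) := by field_simp
        _ ≤ _ := mul_le_mul_of_nonneg_left h7 (by positivity)
    · have := h.pos x; have := h.scale_pos x; have := hEB x
      calc 2 / κ * (u x * s x * E x) ≤ 2 / κ * (u x * s x * B) := by gcongr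
        _ = _ := by ring
  · refine (lintegral_Iic_le (g := fun t => u t / s t ^ 2)
      (h := fun t => 2 / κ * (u t / s t * E t))
      (huc.div (hsc.pow 2) fun x => (pow_pos (h.scale_pos x) 2).ne')
      (fun t _ => (((h.hasDerivAt t).fun_div (h.scale_hasDerivAt t) (h.scale_pos t).ne').fun_mul
        (hE t)).const_mul (2 / κ))
      (fun t _ => ?_) (fun t _ => ?_) (fun t _ => ?_)).trans
      (ENNReal.ofReal_le_ofReal ?_)
    · have := h.pos t; have := h.scale_pos t; have := hE0 t; positivity
    · have := h.pos t; have := h.scale_pos t; positivity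
    · have hs := h.scale_pos t
      have h1 := h.growth t
      have h2 := (abs_le.1 (le_refl |s' t|)).2
      have h3 := mul_le_mul_of_nonneg_left (hkey t) (h.pos t).le
      have h4 := mul_le_mul_of_nonneg_right h1 (hE0 t).le
      have h5 := mul_le_mul_of_nonneg_left h2 (mul_pos (h.pos t) (hE0 t)).le
      have h6 := mul_le_mul_of_nonneg_left (hE1 t) (h.pos t).le
      have h7 : κ / 2 * u t ≤ (u' t * s t - u t * s' t) * E t + u t * s t * E' t := by nlinarith
      calc u t / s t ^ 2 = 2 / κ * (κ / 2 * u t / s t ^ 2) := by field_simp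
        _ ≤ 2 / κ * (((u' t * s t - u t * s' t) * E t + u t * s t * E' t) / s t ^ 2) := by gcongr
        _ = _ := by field_simp
    · have := h.pos x; have := h.scale_pos x; have := hEB x
      calc 2 / κ * (u x / s x * E x) ≤ 2 / κ * (u x / s x * B) := by gcongr
        _ = _ := by ring

/-- The derivative of `u / s²` has the sign of `s u' - 2 u s'`, which is at least `(κ - κ / 2) u`
once `|s'| ≤ κ / 4`. -/
theorem exists_sq_le (h : IsGrowth u u' s s' κ R) :
    ∃ c X : ℝ, 0 < c ∧ ∀ x, X ≤ x → c * s x ^ 2 ≤ u x := by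
  set X := max R 0
  have hsX := h.scale_pos X
  have huX := h.pos X
  have hd : ∀ x, HasDerivAt (fun x => u x / s x ^ 2)
      ((u' x * s x ^ 2 - u x * (2 * s x * s' x)) / (s x ^ 2) ^ 2) x := fun x => by
    have h1 := (h.scale_hasDerivAt x).pow 2
    refine ((h.hasDerivAt x).div h1 (pow_pos (h.scale_pos x) 2).ne').congr_deriv ?_
    simp
  have hmono : MonotoneOn (fun x => u x / s x ^ 2) (Ici X) := by
    refine monotoneOn_of_deriv_nonneg (convex_Ici X)
      (fun x _ => (hd x).continuousAt.continuousWithinAt)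
      (fun x _ => (hd x).differentiableAt.differentiableWithinAt) fun x hx => ?_
    rw [interior_Ici] at hx
    have hxR : R ≤ |x| := ((le_max_left R 0).trans (le_of_lt hx)).trans (le_abs_self x)
    rw [(hd x).deriv]
    have h1 := h.growth x
    have h2 := (abs_le.1 (h.slope_le x hxR)).2
    have hs := h.scale_pos x
    have hu := h.pos x
    have hκ := h.rate_pos
    refine div_nonneg ?_ (by positivity)
    have h3 : 0 ≤ s x * u' x - u x * (2 * s' x) := by nlinarith
    nlinarith [mul_nonneg hs.le h3]
  refine ⟨u X / s X ^ 2, X, by positivity, fun x hx => ?_⟩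
  have h1 := hmono self_mem_Ici hx hx
  have hs := h.scale_pos x
  simp only at h1
  rwa [le_div_iff₀ (by positivity)] at h1

end IsGrowth

/-- A principal solution grows exponentially at the length scale `s`. -/
theorem exists_isGrowth {q s s' : ℝ → ℝ} (hq : ∀ a b : ℝ, IntervalIntegrable q volume a b)
    (hq0 : ∀ᵐ x : ℝ, 0 ≤ q x) (ht : LeftTail q)
    (hs : ∀ x, HasDerivAt s (s' x) x) (hs0 : ∀ x, 0 < s x) (hs1 : ∀ x, |s' x| ≤ 1)
    (hlim : ∀ ε > 0, ∃ R : ℝ, ∀ x, R ≤ |x| → |s' x| ≤ ε)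
    (hmass : ∃ R : ℝ, ∀ x, R ≤ |x| → 1 ≤ 2 * s x * ∫ t in (x - s x)..x, q t) :
    ∃ u u' : ℝ → ℝ, ∃ κ R : ℝ, IsHom q u u' ∧ (∀ x, 0 < u' x) ∧ IsGrowth u u' s s' κ R := by
  obtain ⟨u, u', hu, hu0, hu1⟩ := exists_principal hq hq0 ht
  obtain ⟨R, hR⟩ := hmass
  have hsc : Continuous s := continuous_iff_continuousAt.2 fun x => (hs x).continuousAt
  -- Far out `κ = 1 / 3` works by `IsHom.le_three_mul`; on the remaining compact interval `s u' / u`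
  -- has a positive minimum.
  have hgrow : ∃ κ : ℝ, 0 < κ ∧ ∀ x, κ * u x ≤ s x * u' x := by
    have hne : (Icc (-max R 0) (max R 0)).Nonempty :=
      ⟨0, by simp, le_max_right _ _⟩
    obtain ⟨x₀, -, hmin⟩ := isCompact_Icc.exists_isMinOn hne
      (((hsc.mul hu.prim.continuous).div hu.continuous fun x => (hu0 x).ne').continuousOn
        (s := Icc (-max R 0) (max R 0)))
    have hm0 : 0 < s x₀ * u' x₀ / u x₀ := div_pos (mul_pos (hs0 _) (hu1 _)) (hu0 _)
    refine ⟨min (1 / 3) (s x₀ * u' x₀ / u x₀), lt_min (by norm_num) hm0, fun x => ?_⟩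
    rcases le_total |x| (max R 0) with hx | hx
    · have h1 : s x₀ * u' x₀ / u x₀ ≤ s x * u' x / u x := hmin (abs_le.1 hx)
      rw [← le_div_iff₀ (hu0 x)]
      exact (min_le_right _ _).trans h1
    · have h1 := hu.le_three_mul hq hq0 hu0 hu1 (hs0 x) (hR x ((le_max_left _ _).trans hx))
      have h2 := mul_le_mul_of_nonneg_right (min_le_left (1 / 3) (s x₀ * u' x₀ / u x₀)) (hu0 x).le
      linarith
  obtain ⟨κ, hκ, hκ'⟩ := hgrow
  obtain ⟨R', hR'⟩ := hlim (κ / 4) (by positivity)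
  exact ⟨u, u', κ, R', hu, hu1, hu.hasDerivAt, hu0, hs, hs0, hs1, hκ, hκ', hR'⟩

/-! ### Schur's test and the Green pair. -/

/-- Schur test: a kernel whose row and column integrals are at most `D` acts on `L_p` with norm at
most `D`. -/
theorem schur_test {N : ℝ → ℝ → ℝ≥0∞} (hN : Measurable (Function.uncurry N)) {D : ℝ≥0∞}
    (hD0 : D ≠ 0) (hD : D ≠ ∞) (hrow : ∀ x, ∫⁻ t, N x t ≤ D) (hcol : ∀ t, ∫⁻ x, N x t ≤ D)
    {g : ℝ → ℝ≥0∞} (hg : AEMeasurable g volume) {p : ℝ} (hp : 1 ≤ p) :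
    ∫⁻ x, (∫⁻ t, N x t * g t) ^ p ≤ D ^ p * ∫⁻ t, g t ^ p := by
  have hp0 : 0 < p := by linarith
  have hNx : ∀ x, Measurable (N x) := fun x => hN.comp measurable_prodMk_left
  -- Comparison of the `L_1` and `L_p` norms for the measure `N x t dt`, whose total mass is at most
  -- `D`.
  have h1 : ∀ x, (∫⁻ t, N x t * g t) ^ p ≤ D ^ (p - 1) * ∫⁻ t, N x t * g t ^ p := by
    intro x
    have hg' : AEMeasurable g (volume.withDensity (N x)) :=
      hg.mono_ac (withDensity_absolutelyContinuous _ _)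
    have h2 := eLpNorm'_le_eLpNorm'_mul_rpow_measure_univ zero_lt_one hp
      hg'.aestronglyMeasurable
    simp only [eLpNorm'_eq_lintegral_enorm, enorm_eq_self, ENNReal.rpow_one, div_one] at h2
    rw [lintegral_withDensity_eq_lintegral_mul₀ (hNx x).aemeasurable hg,
      lintegral_withDensity_eq_lintegral_mul₀ (hNx x).aemeasurable (hg.pow_const p),
      withDensity_apply _ MeasurableSet.univ, Measure.restrict_univ] at h2
    simp only [Pi.mul_apply] at h2
    refine (ENNReal.rpow_le_rpow h2 hp0.le).trans ?_
    rw [ENNReal.mul_rpow_of_nonneg _ _ hp0.le, ← ENNReal.rpow_mul, ← ENNReal.rpow_mul,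
      one_div_mul_cancel hp0.ne', ENNReal.rpow_one, mul_comm,
      show (1 - 1 / p) * p = p - 1 by field_simp]
    gcongr
    exact hrow x
  have hm : AEMeasurable (Function.uncurry fun x t => N x t * g t ^ p)
      ((volume : Measure ℝ).prod volume) :=
    hN.aemeasurable.mul ((hg.pow_const p).comp_snd)
  calc ∫⁻ x, (∫⁻ t, N x t * g t) ^ p
      ≤ ∫⁻ x, D ^ (p - 1) * ∫⁻ t, N x t * g t ^ p := lintegral_mono h1
    _ = D ^ (p - 1) * ∫⁻ x, ∫⁻ t, N x t * g t ^ p :=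
        lintegral_const_mul' _ _ (ENNReal.rpow_ne_top_of_nonneg (by linarith) hD)
    _ = D ^ (p - 1) * ∫⁻ t, ∫⁻ x, N x t * g t ^ p := by rw [lintegral_lintegral_swap hm]
    _ ≤ D ^ (p - 1) * ∫⁻ t, D * g t ^ p := by
        gcongr with t
        have hNt : Measurable fun x => N x t := hN.comp measurable_prodMk_right
        rw [lintegral_mul_const _ hNt]
        gcongr
        exact hcol t
    _ = D ^ p * ∫⁻ t, g t ^ p := by
        rw [lintegral_const_mul' _ _ hD, ← mul_assoc]
        congr 1
        conv_lhs => rw [← ENNReal.rpow_one D, ← ENNReal.rpow_mul, one_mul]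
        rw [← ENNReal.rpow_add _ _ hD0 hD, sub_add_cancel]

/-- Principal solutions `u`, `v` at `-∞` and `+∞` with the estimates that control the Green function
`G(x,t) = u(min(x,t)) v(max(x,t)) / W` at the length scale `s`. -/
structure IsGreenPair (q s u u' v v' : ℝ → ℝ) (W C : ℝ) : Prop where
  left : IsHom q u u'
  right : IsHom q v v'
  left_pos : ∀ x, 0 < u x
  right_pos : ∀ x, 0 < v x
  left_deriv_pos : ∀ x, 0 < u' x
  right_deriv_neg : ∀ x, v' x < 0
  wronskian : ∀ x, u' x * v x - u x * v' x = W
  wronskian_pos : 0 < W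
  const_pos : 0 < C
  scale_continuous : Continuous s
  scale_pos : ∀ x, 0 < s x
  diag : ∀ x, u x * v x ≤ C * s x
  left_lintegral : ∀ x, ∫⁻ t in Iic x, ENNReal.ofReal (u t) ≤ ENNReal.ofReal (C * (u x * s x))
  left_lintegral_div : ∀ x, ∫⁻ t in Iic x, ENNReal.ofReal (u t / s t ^ 2) ≤
    ENNReal.ofReal (C * (u x / s x))
  right_lintegral : ∀ x, ∫⁻ t in Ici x, ENNReal.ofReal (v t) ≤ ENNReal.ofReal (C * (v x * s x))
  right_lintegral_div : ∀ x, ∫⁻ t in Ici x, ENNReal.ofReal (v t / s t ^ 2) ≤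
    ENNReal.ofReal (C * (v x / s x))
  left_large : ∃ c X : ℝ, 0 < c ∧ ∀ x, X ≤ x → c * s x ^ 2 ≤ u x
  right_large : ∃ c X : ℝ, 0 < c ∧ ∀ x, x ≤ X → c * s x ^ 2 ≤ v x

theorem lintegral_Iic_comp_neg (g : ℝ → ℝ≥0∞) (x : ℝ) :
    ∫⁻ t in Iic (-x), g (-t) = ∫⁻ t in Ici x, g t := by
  have h := (Measure.measurePreserving_neg (volume : Measure ℝ)).setLIntegral_comp_preimage_emb
    (Homeomorph.neg ℝ).measurableEmbedding g (Ici x)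
  rw [← h]
  simp

theorem exists_isGreenPair {q : ℝ → ℝ} (hq : LocallyIntegrable q volume)
    (hq0 : ∀ᵐ x : ℝ, 0 ≤ q x) (ht : PositiveTails q) (hH : InClassH q) :
    ∃ u u' v v' : ℝ → ℝ, ∃ W C : ℝ,
      IsGreenPair q (fun x => Real.sqrt 2 * d q x) u u' v v' W C := by
  have hii : ∀ a b : ℝ, IntervalIntegrable q volume a b := fun a b =>
    (hq.integrableOn_isCompact isCompact_uIcc).intervalIntegrable
  have hnu := nu_eq hq
  have hs := isScale hq hq0 ht
  have hQ := IsPrim.of_intervalIntegrable hii 0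
  set Q : ℝ → ℝ := fun x => ∫ t in (0 : ℝ)..x, q t with hQdef
  set s : ℝ → ℝ := fun x => Real.sqrt 2 * d q x with hsdef
  have hνlim : ∀ ε > 0, ∃ R : ℝ, ∀ x, R ≤ |x| →
      |s x * (Q (x + s x) - 2 * Q x + Q (x - s x))| ≤ ε := by
    intro ε hε
    have h1 : Tendsto (fun x => Real.sqrt 2 * nu q x) (atBot ⊔ atTop) (𝓝 0) := by
      simpa using hH.const_mul (Real.sqrt 2)
    have h2 := h1.eventually (Metric.ball_mem_nhds 0 hε)
    rw [eventually_sup, eventually_atBot, eventually_atTop] at h2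
    obtain ⟨⟨a, ha⟩, ⟨b, hb⟩⟩ := h2
    refine ⟨max (-a) b, fun x hx => ?_⟩
    have h3 : Real.sqrt 2 * nu q x ∈ Metric.ball (0 : ℝ) ε := by
      rcases le_total 0 x with h | h
      · rw [abs_of_nonneg h] at hx
        exact hb x ((le_max_right _ _).trans hx)
      · rw [abs_of_nonpos h] at hx
        exact ha x (by linarith [(le_max_left (-a) b).trans hx])
    rw [mem_ball_zero_iff, Real.norm_eq_abs, hnu x] at h3
    exact h3.le
  have hslim : ∀ ε > 0, ∃ R : ℝ, ∀ x, R ≤ |x| → |IsScale.slope Q s x| ≤ ε := by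
    intro ε hε
    obtain ⟨R, hR⟩ := hνlim (2 * ε) (by positivity)
    exact ⟨R, fun x hx => (hs.abs_slope_le x).trans (by linarith [hR x hx])⟩
  obtain ⟨R, hR⟩ := hνlim 1 one_pos
  obtain ⟨u, u', κ, R₁, hu, hu1, hug⟩ := exists_isGrowth hii hq0 (leftTail hii hq0 ht)
    hs.hasDerivAt_scale hs.pos hs.abs_slope_le_one hslim
    ⟨R, fun x hx => by rw [hQ.2]; exact hs.half_mass_left (hR x hx)⟩
  have hii' : ∀ a b : ℝ, IntervalIntegrable (fun x => q (-x)) volume a b := fun a b =>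
    (IntervalIntegrable.iff_comp_neg (a := a) (b := b) (f := fun x => q (-x))).2
      (by simpa using hii (-a) (-b))
  have hq0' : ∀ᵐ x : ℝ, 0 ≤ q (-x) :=
    (Measure.measurePreserving_neg (volume : Measure ℝ)).quasiMeasurePreserving.ae hq0
  -- The solution decaying to the right is the reflection of the principal solution for `q (-x)`;
  -- the right half-window supplies its mass.
  obtain ⟨w, w', κ', R₂, hw, hw1, hwg⟩ := exists_isGrowth hii' hq0' (leftTail_comp_neg hii hq0 ht)
    (s := fun x => s (-x)) (s' := fun x => -IsScale.slope Q s (-x))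
    (fun x => by
      simpa [Function.comp_def] using (hs.hasDerivAt_scale (-x)).scomp x (hasDerivAt_neg x))
    (fun x => hs.pos _) (fun x => by rw [abs_neg]; exact hs.abs_slope_le_one _)
    (fun ε hε => by
      obtain ⟨R, hR⟩ := hslim ε hε
      exact ⟨R, fun x hx => by rw [abs_neg]; exact hR _ (by rwa [abs_neg])⟩)
    ⟨R, fun x hx => by
      rw [intervalIntegral.integral_comp_neg, hQ.2]
      have := hs.half_mass_right (hR (-x) (by rwa [abs_neg]))
      rwa [show -(x - s (-x)) = -x + s (-x) by ring]⟩
  have hv := hw.comp_neg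
  simp only [neg_neg] at hv
  obtain ⟨C₁, hC₁, hl1, hl2⟩ := hug.exists_lintegral_le
  obtain ⟨C₂, hC₂, hr1, hr2⟩ := hwg.exists_lintegral_le
  set W := u' 0 * w (-0) - u 0 * -w' (-0) with hW
  have hwr : ∀ x, u' x * w (-x) - u x * -w' (-x) = W := fun x => hu.wronskian hv x 0
  have hWpos : 0 < W := by
    have := mul_pos (hu1 0) (hwg.pos (-0))
    have := mul_pos (hug.pos 0) (hw1 (-0))
    rw [hW]; linarith
  have hκ := hug.rate_pos
  set C := max (max C₁ C₂) (W / κ) with hC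
  have hCC₁ : C₁ ≤ C := (le_max_left _ _).trans (le_max_left _ _)
  have hCC₂ : C₂ ≤ C := (le_max_right _ _).trans (le_max_left _ _)
  have hCW : W / κ ≤ C := le_max_right _ _
  refine ⟨u, u', fun x => w (-x), fun x => -w' (-x), W, C, hu, hv, hug.pos, fun x => hwg.pos _, hu1,
    fun x => neg_neg_of_pos (hw1 _), hwr, hWpos, hC₁.trans_le hCC₁, hs.continuous, hs.pos,
    fun x => ?_, fun x => ?_, fun x => ?_, fun x => ?_, fun x => ?_, hug.exists_sq_le, ?_⟩
  -- Both terms of the Wronskian are positive, so `W ≥ u' v ≥ κ u v / s`.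
  · have h1 := mul_le_mul_of_nonneg_right (hug.growth x) (hwg.pos (-x)).le
    have h2 := mul_pos (hug.pos x) (hw1 (-x))
    have h3 := mul_le_mul_of_nonneg_right hCW (hs.pos x).le
    have h4 : κ * (u x * w (-x)) ≤ W * s x := by
      rw [← hwr x]
      nlinarith [mul_pos (hs.pos x) h2]
    refine le_trans ?_ h3
    rw [div_mul_eq_mul_div, le_div_iff₀ hκ]
    linarith
  · have := hug.pos x
    have := hs.pos x
    exact (hl1 x).trans (ENNReal.ofReal_le_ofReal (by gcongr))
  · have := hug.pos x
    have := hs.pos x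
    exact (hl2 x).trans (ENNReal.ofReal_le_ofReal (by gcongr))
  · have h1 := hr1 (-x)
    have := hwg.pos (-x)
    have := hs.pos x
    rw [← lintegral_Iic_comp_neg]
    simp only [neg_neg] at h1 ⊢
    exact h1.trans (ENNReal.ofReal_le_ofReal (by gcongr))
  · have h1 := hr2 (-x)
    have := hwg.pos (-x)
    have := hs.pos x
    rw [← lintegral_Iic_comp_neg]
    simp only [neg_neg] at h1 ⊢
    exact h1.trans (ENNReal.ofReal_le_ofReal (by gcongr))
  · obtain ⟨c, X, hc, h⟩ := hwg.exists_sq_le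
    refine ⟨c, -X, hc, fun x hx => ?_⟩
    simpa using h (-x) (by linarith)

/-! ### Uniqueness in the weighted space. -/

/-- If `α ≠ 0`, the growth of `u` absorbs the bounded `v`, and the weighted function is at least
`|α| c / W` in modulus on a half-line. This set has infinite measure, contradicting Markov's
inequality. -/
theorem coeff_eq_zero {s u v : ℝ → ℝ} {α β c X B W : ℝ} (hc : 0 < c) (hW : 0 < W)
    (hs : ∀ x, 0 < s x) (hlarge : ∀ x, X ≤ x → c * s x ^ 2 ≤ u x)
    (hv : ∀ x, X ≤ x → |v x| ≤ B) (hu : Tendsto u atTop atTop) {p : ℝ≥0∞} (hp : p ≠ 0)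
    (hp' : p ≠ ∞) (h : MemLp (fun x => 2 / s x ^ 2 * ((α * u x - β * v x) / W)) p volume) :
    α = 0 := by
  by_contra hα
  have hα' : 0 < |α| := abs_pos.2 hα
  obtain ⟨Y, hY⟩ := eventually_atTop.1 (hu.eventually_ge_atTop (2 * (|β| * B) / |α|))
  have hε : 0 < |α| * c / W := by positivity
  have h1 := h.meas_ge_lt_top hp hp' (ε := ⟨|α| * c / W, hε.le⟩)
    (fun h => hε.ne' (congrArg NNReal.toReal h))
  have h2 : Ici (max X Y) ⊆ {x | (⟨|α| * c / W, hε.le⟩ : NNReal) ≤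
      ‖2 / s x ^ 2 * ((α * u x - β * v x) / W)‖₊} := by
    intro x hx
    have hX : X ≤ x := (le_max_left _ _).trans hx
    have h3 := hY x ((le_max_right _ _).trans hx)
    have h4 := hlarge x hX
    have h5 := hv x hX
    have hsx := hs x
    rw [div_le_iff₀ hα'] at h3
    have hux : 0 < u x := lt_of_lt_of_le (by positivity) h4
    have h6 : |α| * u x - |β| * |v x| ≤ |α * u x - β * v x| := by
      have := abs_sub_abs_le_abs_sub (α * u x) (β * v x)
      rwa [abs_mul, abs_mul, abs_of_pos hux] at this
    have h7 := mul_le_mul_of_nonneg_left h5 (abs_nonneg β)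
    have h8 : |α| * u x / 2 ≤ |α * u x - β * v x| := by linarith
    change |α| * c / W ≤ ‖2 / s x ^ 2 * ((α * u x - β * v x) / W)‖
    rw [Real.norm_eq_abs, abs_mul, abs_div, abs_div, abs_of_pos hW,
      abs_of_pos (by positivity : 0 < s x ^ 2), abs_two]
    calc |α| * c / W = 2 / s x ^ 2 * (|α| * (c * s x ^ 2) / 2 / W) := by field_simp
      _ ≤ 2 / s x ^ 2 * (|α| * u x / 2 / W) := by gcongr
      _ ≤ _ := by gcongr
  have h3 := (measure_mono h2).trans_lt h1
  rw [Real.volume_Ici] at h3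
  exact lt_irrefl _ h3

namespace IsGreenPair

variable {q s u u' v v' : ℝ → ℝ} {W C : ℝ}

theorem monotone_left (h : IsGreenPair q s u u' v v' W C) : Monotone u :=
  monotone_of_deriv_nonneg (fun x => (h.left.hasDerivAt x).differentiableAt)
    fun x => by rw [(h.left.hasDerivAt x).deriv]; exact (h.left_deriv_pos x).le

theorem antitone_right (h : IsGreenPair q s u u' v v' W C) : Antitone v :=
  antitone_of_deriv_nonpos (fun x => (h.right.hasDerivAt x).differentiableAt)
    fun x => by rw [(h.right.hasDerivAt x).deriv]; exact (h.right_deriv_neg x).le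

theorem tendsto_left (h : IsGreenPair q s u u' v v' W C) (hq0 : ∀ᵐ x : ℝ, 0 ≤ q x) :
    Tendsto u atTop atTop := by
  have hmono := h.left.monotone_deriv hq0 fun x => (h.left_pos x).le
  have h1 : Tendsto (fun x => u' 0 * x + u 0) atTop atTop :=
    tendsto_atTop_add_const_right _ _ (tendsto_id.const_mul_atTop (h.left_deriv_pos 0))
  refine tendsto_atTop_mono' _ ?_ h1
  filter_upwards [eventually_ge_atTop 0] with x hx
  have := (sub_le_mul_of_monotone_deriv h.left.hasDerivAt hmono hx).1
  linarith

theorem tendsto_right (h : IsGreenPair q s u u' v v' W C) (hq0 : ∀ᵐ x : ℝ, 0 ≤ q x) :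
    Tendsto v atBot atTop := by
  have hmono := h.right.monotone_deriv hq0 fun x => (h.right_pos x).le
  have h1 : Tendsto (fun x => v' 0 * x + v 0) atBot atTop :=
    tendsto_atTop_add_const_right _ _ (tendsto_id.const_mul_atBot_of_neg (h.right_deriv_neg 0))
  refine tendsto_atTop_mono' _ ?_ h1
  filter_upwards [eventually_le_atBot 0] with x hx
  have := (sub_le_mul_of_monotone_deriv h.right.hasDerivAt hmono hx).2
  linarith

/-- The homogeneous equation has no nonzero solution in the weighted space. -/
theorem eq_zero_of_memLp (h : IsGreenPair q s u u' v v' W C) (hq0 : ∀ᵐ x : ℝ, 0 ≤ q x)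
    {p : ℝ≥0∞} (hp : p ≠ 0) (hp' : p ≠ ∞) {y y' : ℝ → ℝ} (hy : IsHom q y y')
    (hm : MemLp (fun x => 2 / s x ^ 2 * y x) p volume) (x : ℝ) : y x = 0 := by
  have hW := h.wronskian_pos
  -- The coordinates of `y` in the basis `u`, `v` are, up to sign and the factor `1 / W`, its
  -- Wronskians with `v` and `u`.
  set α := y' 0 * v 0 - y 0 * v' 0
  set β := y' 0 * u 0 - y 0 * u' 0
  have hα : ∀ x, y' x * v x - y x * v' x = α := fun x => hy.wronskian h.right x 0
  have hβ : ∀ x, y' x * u x - y x * u' x = β := fun x => hy.wronskian h.left x 0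
  have hyx : ∀ x, y x = (α * u x - β * v x) / W := fun x => by
    rw [eq_div_iff hW.ne', ← hα x, ← hβ x, ← h.wronskian x]; ring
  simp_rw [hyx] at hm
  obtain ⟨c, X, hc, hX⟩ := h.left_large
  obtain ⟨c', X', hc', hX'⟩ := h.right_large
  have hα0 : α = 0 := by
    refine coeff_eq_zero (X := max X 0) (B := v 0) hc hW h.scale_pos
      (fun x hx => hX x ((le_max_left _ _).trans hx)) (fun x hx => ?_) (h.tendsto_left hq0) hp hp' hm
    rw [abs_of_pos (h.right_pos x)]
    exact h.antitone_right ((le_max_right _ _).trans hx)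
  -- Reflection exchanges the roles of `u` and `v`; the sign change makes `β` the leading
  -- coefficient.
  have hm' := (hm.neg).comp_measurePreserving (Measure.measurePreserving_neg (volume : Measure ℝ))
  have hβ0 : β = 0 := by
    refine coeff_eq_zero (s := fun x => s (-x)) (u := fun x => v (-x)) (v := fun x => u (-x))
      (β := α) (X := max (-X') 0) (B := u 0) hc' hW (fun x => h.scale_pos _)
      (fun x hx => hX' (-x) (by linarith [(le_max_left (-X') 0).trans hx])) (fun x hx => ?_)
      ((h.tendsto_right hq0).comp tendsto_neg_atTop_atBot) hp hp' ?_
    · rw [abs_of_pos (h.left_pos _)]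
      exact h.monotone_left (by linarith [(le_max_right (-X') 0).trans hx])
    · convert hm' using 2 with x
      simp only [Function.comp, Pi.neg_apply]
      ring
  rw [hyx, hα0, hβ0]
  simp

end IsGreenPair

/-! ### The Green operator on `L_p`. -/

/-- The inequality `|f| ≤ 1 + |f|^p` replaces Hölder and treats all `p ≥ 1` alike: `w` is integrable
against 1 and bounded against `|f|^p`. -/
theorem integrableOn_mul_of_memLp {w f : ℝ → ℝ} {S : Set ℝ} (hS : MeasurableSet S) {M : ℝ}
    (hw : Continuous w) (hwS : IntegrableOn w S) (hw0 : ∀ x, 0 ≤ w x) (hM : ∀ x ∈ S, w x ≤ M)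
    {p : ℝ≥0∞} (hp : 1 ≤ p) (hp' : p ≠ ∞) (hf : MemLp f p volume) :
    IntegrableOn (fun t => w t * f t) S := by
  have hp0 : p ≠ 0 := (zero_lt_one.trans_le hp).ne'
  have hp1 : 1 ≤ p.toReal := by
    rw [← ENNReal.toReal_one]; exact ENNReal.toReal_mono hp' hp
  have h1 : IntegrableOn (fun t => ‖f t‖ ^ p.toReal) S :=
    (hf.integrable_norm_rpow hp0 hp').integrableOn
  refine Integrable.mono' (hwS.add (h1.const_mul M))
    (hw.aestronglyMeasurable.mul hf.1.restrict) ?_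
  filter_upwards [ae_restrict_mem hS] with t ht
  have h2 : ‖f t‖ ≤ 1 + ‖f t‖ ^ p.toReal := by
    rcases le_total ‖f t‖ 1 with h | h
    · linarith [Real.rpow_nonneg (norm_nonneg (f t)) p.toReal]
    · have := Real.rpow_le_rpow_of_exponent_le h hp1
      rw [Real.rpow_one] at this
      linarith
  have h3 := mul_le_mul_of_nonneg_left h2 (hw0 t)
  have h4 := mul_le_mul_of_nonneg_right (hM t ht) (Real.rpow_nonneg (norm_nonneg (f t)) p.toReal)
  rw [norm_mul, Real.norm_of_nonneg (hw0 t)]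
  simp only [Pi.add_apply]
  linarith

theorem integrableOn_of_lintegral_ofReal_le {w : ℝ → ℝ} {S : Set ℝ} (hw : Continuous w)
    (hw0 : ∀ x, 0 ≤ w x) {c : ℝ} (h : ∫⁻ t in S, ENNReal.ofReal (w t) ≤ ENNReal.ofReal c) :
    IntegrableOn w S := by
  refine ⟨hw.aestronglyMeasurable, ?_⟩
  rw [hasFiniteIntegral_iff_ofReal (Eventually.of_forall hw0)]
  exact h.trans_lt ENNReal.ofReal_lt_top

/-- The kernel of the operator `f ↦ 2 s⁻² y`, where `y` is the solution given by the Green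
function. -/
noncomputable def greenKernel (s u v : ℝ → ℝ) (W x t : ℝ) : ℝ≥0∞ :=
  if t ≤ x then ENNReal.ofReal (2 / W * (v x / s x ^ 2) * u t)
  else ENNReal.ofReal (2 / W * (u x / s x ^ 2) * v t)

namespace IsGreenPair

variable {q s u u' v v' : ℝ → ℝ} {W C : ℝ}

theorem measurable_greenKernel (h : IsGreenPair q s u u' v v' W C) :
    Measurable (Function.uncurry (greenKernel s u v W)) := by
  have hu := h.left.continuous.measurable
  have hv := h.right.continuous.measurable
  have hs := h.scale_continuous.measurable
  refine Measurable.ite (measurableSet_le measurable_snd measurable_fst) ?_ ?_ <;> fun_prop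

theorem lintegral_greenKernel_mul (h : IsGreenPair q s u u' v v' W C) (x : ℝ) (g : ℝ → ℝ≥0∞) :
    ∫⁻ t, greenKernel s u v W x t * g t =
      ENNReal.ofReal (2 / W * (v x / s x ^ 2)) * (∫⁻ t in Iic x, ENNReal.ofReal (u t) * g t) +
      ENNReal.ofReal (2 / W * (u x / s x ^ 2)) * ∫⁻ t in Ioi x, ENNReal.ofReal (v t) * g t := by
  have hW := h.wronskian_pos
  have hs := h.scale_pos x
  have hu := h.left_pos x
  have hv := h.right_pos x
  rw [← lintegral_add_compl _ (measurableSet_Iic (a := x)), compl_Iic,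
    ← lintegral_const_mul' _ _ ENNReal.ofReal_ne_top,
    ← lintegral_const_mul' _ _ ENNReal.ofReal_ne_top]
  congr 1
  · refine setLIntegral_congr_fun measurableSet_Iic fun t ht => ?_
    simp only [greenKernel, if_pos (mem_Iic.1 ht)]
    rw [ENNReal.ofReal_mul (by positivity), mul_assoc]
  · refine setLIntegral_congr_fun measurableSet_Ioi fun t ht => ?_
    simp only [greenKernel, if_neg (not_le.2 (mem_Ioi.1 ht))]
    rw [ENNReal.ofReal_mul (by positivity), mul_assoc]

/-- The integrals of `u` and `v` supply a factor `C s`, so each half is at most `2 C u v / (W s)`,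
and `u v ≤ C s`. -/
theorem lintegral_greenKernel_row (h : IsGreenPair q s u u' v v' W C) (x : ℝ) :
    ∫⁻ t, greenKernel s u v W x t ≤ ENNReal.ofReal (4 * C ^ 2 / W) := by
  have hW := h.wronskian_pos
  have hC := h.const_pos
  have hs := h.scale_pos x
  have hu := h.left_pos x
  have hv := h.right_pos x
  have h1 := h.lintegral_greenKernel_mul x 1
  simp only [Pi.one_apply, mul_one] at h1
  rw [h1]
  have h2 : ∫⁻ t in Ioi x, ENNReal.ofReal (v t) ≤ ENNReal.ofReal (C * (v x * s x)) :=
    (lintegral_mono_set Ioi_subset_Ici_self).trans (h.right_lintegral x)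
  refine (add_le_add (mul_le_mul_right (h.left_lintegral x) _)
    (mul_le_mul_right h2 _)).trans ?_
  rw [← ENNReal.ofReal_mul (by positivity), ← ENNReal.ofReal_mul (by positivity),
    ← ENNReal.ofReal_add (by positivity) (by positivity)]
  refine ENNReal.ofReal_le_ofReal ?_
  have h3 : u x * v x / s x ≤ C := (div_le_iff₀ hs).2 (h.diag x)
  calc 2 / W * (v x / s x ^ 2) * (C * (u x * s x)) + 2 / W * (u x / s x ^ 2) * (C * (v x * s x))
      = 4 * C / W * (u x * v x / s x) := by field_simp; ring
    _ ≤ 4 * C / W * C := by gcongr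
    _ = 4 * C ^ 2 / W := by ring

/-- Here the weight `s⁻²` is integrated too, hence the bounds on the integrals of `u / s²` and `v /
s²`. -/
theorem lintegral_greenKernel_col (h : IsGreenPair q s u u' v v' W C) (t : ℝ) :
    ∫⁻ x, greenKernel s u v W x t ≤ ENNReal.ofReal (4 * C ^ 2 / W) := by
  have hW := h.wronskian_pos
  have hC := h.const_pos
  have hs := h.scale_pos t
  have hu := h.left_pos t
  have hv := h.right_pos t
  rw [← lintegral_add_compl _ (measurableSet_Ici (a := t)), compl_Ici]
  have h1 : ∫⁻ x in Ici t, greenKernel s u v W x t =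
      ENNReal.ofReal (2 / W * u t) * ∫⁻ x in Ici t, ENNReal.ofReal (v x / s x ^ 2) := by
    rw [← lintegral_const_mul' _ _ ENNReal.ofReal_ne_top]
    refine setLIntegral_congr_fun measurableSet_Ici fun x hx => ?_
    simp only [greenKernel, if_pos (mem_Ici.1 hx)]
    rw [← ENNReal.ofReal_mul (by positivity)]
    congr 1; ring
  have h2 : ∫⁻ x in Iio t, greenKernel s u v W x t =
      ENNReal.ofReal (2 / W * v t) * ∫⁻ x in Iio t, ENNReal.ofReal (u x / s x ^ 2) := by
    rw [← lintegral_const_mul' _ _ ENNReal.ofReal_ne_top]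
    refine setLIntegral_congr_fun measurableSet_Iio fun x hx => ?_
    simp only [greenKernel, if_neg (not_le.2 (mem_Iio.1 hx))]
    rw [← ENNReal.ofReal_mul (by positivity)]
    congr 1; ring
  have h3 : ∫⁻ x in Iio t, ENNReal.ofReal (u x / s x ^ 2) ≤ ENNReal.ofReal (C * (u t / s t)) :=
    (lintegral_mono_set Iio_subset_Iic_self).trans (h.left_lintegral_div t)
  rw [h1, h2]
  refine (add_le_add (mul_le_mul_right (h.right_lintegral_div t) _)
    (mul_le_mul_right h3 _)).trans ?_
  rw [← ENNReal.ofReal_mul (by positivity), ← ENNReal.ofReal_mul (by positivity),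
    ← ENNReal.ofReal_add (by positivity) (by positivity)]
  refine ENNReal.ofReal_le_ofReal ?_
  have h4 : u t * v t / s t ≤ C := (div_le_iff₀ hs).2 (h.diag t)
  calc 2 / W * u t * (C * (v t / s t)) + 2 / W * v t * (C * (u t / s t))
      = 4 * C / W * (u t * v t / s t) := by ring
    _ ≤ 4 * C / W * C := by gcongr
    _ = 4 * C ^ 2 / W := by ring

/-- The solution given by the Green function, with its norm estimate. -/
theorem exists_solution (h : IsGreenPair q s u u' v v' W C)
    {p : ℝ≥0∞} (hp : 1 ≤ p) (hp' : p ≠ ∞) {f : ℝ → ℝ} (hf : MemLp f p volume) :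
    ∃ y : ℝ → ℝ, IsSolution q f y ∧ Continuous y ∧
      eLpNorm (fun x => 2 / s x ^ 2 * y x) p volume ≤
        ENNReal.ofReal (4 * C ^ 2 / W) * eLpNorm f p volume := by
  have hW := h.wronskian_pos
  have hC := h.const_pos
  have hp0 : p ≠ 0 := (zero_lt_one.trans_le hp).ne'
  have hp1 : 1 ≤ p.toReal := by
    rw [← ENNReal.toReal_one]; exact ENNReal.toReal_mono hp' hp
  have hu : ∀ x, IntegrableOn (fun t => u t * f t) (Iic x) := fun x =>
    integrableOn_mul_of_memLp measurableSet_Iic h.left.continuous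
      (integrableOn_of_lintegral_ofReal_le h.left.continuous (fun t => (h.left_pos t).le)
        (h.left_lintegral x)) (fun t => (h.left_pos t).le) (fun t ht => h.monotone_left ht) hp hp' hf
  have hv : ∀ x, IntegrableOn (fun t => v t * f t) (Ioi x) := fun x =>
    (integrableOn_mul_of_memLp measurableSet_Ici h.right.continuous
      (integrableOn_of_lintegral_ofReal_le h.right.continuous (fun t => (h.right_pos t).le)
        (h.right_lintegral x)) (fun t => (h.right_pos t).le) (fun t ht => h.antitone_right ht)
        hp hp' hf).mono_set Ioi_subset_Ici_self
  set A : ℝ → ℝ := fun x => ∫ t in Iic x, u t * f t with hA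
  set B : ℝ → ℝ := fun x => ∫ t in Ioi x, v t * f t with hB
  have hAp : IsPrim A fun t => u t * f t := by
    refine ⟨fun a b => ?_, fun a b => (intervalIntegral.integral_Iic_sub_Iic (hu a) (hu b)).symm⟩
    rw [intervalIntegrable_iff]
    exact (hu (max a b)).mono_set fun t ht => ht.2
  have hBp : IsPrim B fun t => -(v t * f t) := by
    refine ⟨fun a b => ?_, fun a b => ?_⟩
    · refine IntervalIntegrable.neg ?_
      rw [intervalIntegrable_iff]
      exact (hv (min a b)).mono_set fun t ht => ht.1
    · rw [intervalIntegral.integral_neg, ← intervalIntegral.integral_Ioi_sub_Ioi' (hv a) (hv b)]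
      ring
  -- Variation of constants: in the first derivative the terms `v u f` and `-u v f` cancel; in the
  -- second, `(v' u - u' v) f = -W f` gives the right-hand side.
  have h1 : IsPrim (fun x => 1 / W * (v x * A x + u x * B x))
      (fun x => 1 / W * (v' x * A x + u' x * B x)) :=
    (((h.right.prim'.mul hAp).add (h.left.prim'.mul hBp)).const_mul (1 / W)).congr_ae
      (Eventually.of_forall fun x => by ring)
  have h2 : IsPrim (fun x => 1 / W * (v' x * A x + u' x * B x))
      (fun x => q x * (1 / W * (v x * A x + u x * B x)) - f x) :=
    (((h.right.prim.mul hAp).add (h.left.prim.mul hBp)).const_mul (1 / W)).congr_ae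
      (Eventually.of_forall fun x => by
        have h3 := h.wronskian x
        field_simp
        linear_combination (-f x) * h3)
  refine ⟨_, isSolution_of_isPrim (h1.hasDerivAt h2.continuous) h2
    (Eventually.of_forall fun x => by ring), h1.continuous, ?_⟩
  have hpt : ∀ x, ‖2 / s x ^ 2 * (1 / W * (v x * A x + u x * B x))‖ₑ ≤
      ∫⁻ t, greenKernel s u v W x t * ‖f t‖ₑ := by
    intro x
    have hs := h.scale_pos x
    have hux := h.left_pos x
    have hvx := h.right_pos x
    have e1 : ‖A x‖ₑ ≤ ∫⁻ t in Iic x, ENNReal.ofReal (u t) * ‖f t‖ₑ := by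
      refine (enorm_integral_le_lintegral_enorm _).trans (le_of_eq (lintegral_congr fun t => ?_))
      rw [enorm_mul, Real.enorm_of_nonneg (h.left_pos t).le]
    have e2 : ‖B x‖ₑ ≤ ∫⁻ t in Ioi x, ENNReal.ofReal (v t) * ‖f t‖ₑ := by
      refine (enorm_integral_le_lintegral_enorm _).trans (le_of_eq (lintegral_congr fun t => ?_))
      rw [enorm_mul, Real.enorm_of_nonneg (h.right_pos t).le]
    rw [h.lintegral_greenKernel_mul, show 2 / s x ^ 2 * (1 / W * (v x * A x + u x * B x)) =
      2 / W * (v x / s x ^ 2) * A x + 2 / W * (u x / s x ^ 2) * B x by ring]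
    refine (enorm_add_le _ _).trans ?_
    rw [enorm_mul (2 / W * (v x / s x ^ 2)), enorm_mul (2 / W * (u x / s x ^ 2)),
      Real.enorm_of_nonneg (by positivity : 0 ≤ 2 / W * (v x / s x ^ 2)),
      Real.enorm_of_nonneg (by positivity : 0 ≤ 2 / W * (u x / s x ^ 2))]
    gcongr
  have hD : 0 < 4 * C ^ 2 / W := by positivity
  have hschur := schur_test h.measurable_greenKernel (ENNReal.ofReal_pos.2 hD).ne'
    ENNReal.ofReal_ne_top h.lintegral_greenKernel_row h.lintegral_greenKernel_col hf.1.enorm hp1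
  rw [eLpNorm_eq_lintegral_rpow_enorm_toReal hp0 hp', eLpNorm_eq_lintegral_rpow_enorm_toReal hp0 hp']
  have hp3 : 0 < p.toReal := by linarith
  have e3 : (∫⁻ x, ‖2 / s x ^ 2 * (1 / W * (v x * A x + u x * B x))‖ₑ ^ p.toReal) ≤
      ENNReal.ofReal (4 * C ^ 2 / W) ^ p.toReal * ∫⁻ t, ‖f t‖ₑ ^ p.toReal :=
    (lintegral_mono fun x => ENNReal.rpow_le_rpow (hpt x) hp3.le).trans hschur
  refine (ENNReal.rpow_le_rpow e3 (by positivity)).trans (le_of_eq ?_)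
  rw [ENNReal.mul_rpow_of_nonneg _ _ (by positivity), ← ENNReal.rpow_mul,
    mul_one_div_cancel hp3.ne', ENNReal.rpow_one]

theorem admissible (h : IsGreenPair q s u u' v v' W C) (hq0 : ∀ᵐ x : ℝ, 0 ≤ q x)
    (hs : qStar q = fun x => 2 / s x ^ 2) {p : ℝ≥0∞} (hp : 1 ≤ p) (hp' : p < ∞) :
    Admissible q p (qStar q) (fun _ => 1) := by
  have hp0 : p ≠ 0 := (zero_lt_one.trans_le hp).ne'
  have hW := h.wronskian_pos
  have hC := h.const_pos
  have hcont : Continuous fun x => 2 / s x ^ 2 :=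
    continuous_const.div (h.scale_continuous.pow 2) fun x => (pow_pos (h.scale_pos x) 2).ne'
  rw [hs]
  have hex : ∀ f, MemWeightedLp p (fun _ => 1) f → ∃ y : ℝ → ℝ, IsSolution q f y ∧
      MemWeightedLp p (fun x => 2 / s x ^ 2) y ∧ weightedNorm p (fun x => 2 / s x ^ 2) y ≤
        ENNReal.ofReal (4 * C ^ 2 / W) * weightedNorm p (fun _ => 1) f := by
    intro f hf
    have hf' : MemLp f p volume := by simpa using hf.2
    obtain ⟨y, hy, hyc, hyn⟩ := h.exists_solution hp hp'.ne hf'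
    refine ⟨y, hy, ⟨fun K hK => ?_, (hcont.mul hyc).aestronglyMeasurable, ?_⟩, ?_⟩
    · obtain ⟨M, hM⟩ := hK.exists_bound_of_continuousOn hyc.continuousOn
      have : IsFiniteMeasure (volume.restrict K) := ⟨by simpa using hK.measure_lt_top⟩
      exact MemLp.of_bound hyc.aestronglyMeasurable M
        ((ae_restrict_mem hK.measurableSet).mono hM)
    · exact hyn.trans_lt (ENNReal.mul_lt_top ENNReal.ofReal_lt_top hf'.2)
    · simpa [weightedNorm] using hyn
  have huniq : ∀ f y₁ y₂ : ℝ → ℝ, IsSolution q f y₁ → MemWeightedLp p (fun x => 2 / s x ^ 2) y₁ →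
      IsSolution q f y₂ → MemWeightedLp p (fun x => 2 / s x ^ 2) y₂ → y₁ = y₂ := by
    intro f y₁ y₂ h1 hm1 h2 hm2
    obtain ⟨d1, p1⟩ := h1.isPrim
    obtain ⟨d2, p2⟩ := h2.isPrim
    have hhom : IsHom q (fun x => y₁ x - y₂ x) (fun x => deriv y₁ x - deriv y₂ x) :=
      ⟨fun x => (d1 x).sub (d2 x), (p1.sub p2).congr_ae (Eventually.of_forall fun x => by ring)⟩
    have hm : MemLp (fun x => 2 / s x ^ 2 * (y₁ x - y₂ x)) p volume := by
      convert hm1.2.sub hm2.2 using 2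
      simp [mul_sub]
    funext x
    exact sub_eq_zero.1 (h.eq_zero_of_memLp hq0 hp0 hp'.ne hhom hm x)
  refine ⟨⟨hcont, fun x => ?_⟩, ⟨continuous_const, fun _ => one_pos⟩, fun f hf => ?_,
    4 * C ^ 2 / W, by positivity, fun f y hf hy hym => ?_⟩
  · have := h.scale_pos x
    positivity
  · obtain ⟨y, hy, hym, -⟩ := hex f hf
    exact ⟨y, ⟨hy, hym⟩, fun z hz => huniq f z y hz.1 hz.2 hy hym⟩
  · obtain ⟨z, hz, hzm, hzn⟩ := hex f hf
    rwa [huniq f y z hy hym hz hzm]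

end IsGreenPair

end SturmLiouville

theorem theorem4p9 (q : ℝ → ℝ)
    (hq : LocallyIntegrable q volume) (hq0 : ∀ᵐ x : ℝ, 0 ≤ q x)
    (ht : SturmLiouville.PositiveTails q)
    (hH : SturmLiouville.InClassH q)
    (hd : ∀ M : ℝ, ∃ x : ℝ, M < SturmLiouville.d q x)
    (hleft : ∫⁻ x in Iic (0 : ℝ), ENNReal.ofReal (SturmLiouville.qStar q x) = ∞)
    (hright : ∫⁻ x in Ici (0 : ℝ), ENNReal.ofReal (SturmLiouville.qStar q x) = ∞) :
    (∀ p : ℝ≥0∞, 1 ≤ p → p < ∞ →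
      ¬ SturmLiouville.Admissible q p (fun _ => 1) (fun _ => 1)) ∧
    (∀ p : ℝ≥0∞, 1 ≤ p → p < ∞ →
      SturmLiouville.Admissible q p (SturmLiouville.qStar q) (fun _ => 1)) := by
  refine ⟨fun p hp hp' => SturmLiouville.not_admissible_one hq hq0 ht hd hp hp',
    fun p hp hp' => ?_⟩
  obtain ⟨u, u', v, v', W, C, h⟩ := SturmLiouville.exists_isGreenPair hq hq0 ht hH
  exact h.admissible hq0 (funext SturmLiouville.qStar_eq) hp hp'
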